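/- Let $\Gamma$ be a countable (discrete) abelian group, and let $\alpha:\Gamma\to\Gamma$ be an injective homomorphism such that $N:=[\Gamma:\alpha(\Gamma)]$ is finite, $N>1$, and $\bigcap_{n\ge 0}\alpha^n(\Gamma)$ is trivial. Let $\widehat\Gamma$ be the compact dual group with a Haar measure $\mu$, and let $\alpha^*:\widehat\Gamma\to\widehat\Gamma$, $[\alpha^*(\omega)](\gamma)=\omega(\alpha(\gamma))$. All relations between functions on $\widehat\Gamma$ below are understood for $\mu$-almost all $\omega$. Let $m:\widehat\Gamma\to\{0,1,2,\dots\}$ be a multiplicity function, that is, a Borel function with $m(\omega)\le\sum_{\alpha^*(\zeta)=\omega}m(\zeta)$, and put $\sigma_i=\{\omega: m(\omega)\ge i\}$ for $i\ge1$. A *filter* relative to $m$ and $\alpha^*$ is a (possibly infinite) matrix $H=[h_{i,j}]_{i,j\ge1}$ of Borel functions $h_{i,j}:\widehat\Gamma\to\mathbb C$ such that $h_{i,j}$ is supported in $\sigma_j$ and $$\sum_{\alpha^*(\zeta)=\omega}\sum_j h_{i,j}(\zeta)\overline{h_{i',j}(\zeta)}=N\,\delta_{i,i'}\,\chi_{\sigma_i}(\omega)\qquad\text{for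 all } i,i'.$$ Its *Ruelle operator* is the isometry $S_H$ of the Hilbert space $\bigoplus_i L^2(\sigma_i,\mu)$ given by $[S_H f](\omega)=H^t(\omega)f(\alpha^*(\omega))$; it is a *pure* isometry if $\bigcap_{n\ge0}\operatorname{ran}(S_H^n)=\{0\}$. Filters $H$ and $H'$ relative to $m$ and $\alpha^*$ are *equivalent* if there is a Borel matrix-valued function $A$ on $\widehat\Gamma$ of the form $A(\omega)=\begin{pmatrix}A_1(\omega)&0\\0&0\end{pmatrix}$, with $A_1(\omega)$ a unitary matrix of dimension $m(\omega)$, such that $H'(\omega)=A(\alpha^*(\omega))H(\omega)A^*(\omega)$ for almost all $\omega$. An *eigenfilter* is a filter $H$ for which there is a constant $\lambda\in\mathbb C$ with $|\lambda|=1$ such that, for almost all $\omega$, $H_{1,1}(\omega)=\lambda$ and $H_{1,j}(\omega)=0$ for all $j>1$. Let $H$ be a filter relative to $m$ and $\alpha^*$. Then $S_H$ fails to be a pure isometry if and only if $H$ is equivalent to an eigenfilter (relative to the same $m$ and $\alpha^*$). -/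

import Mathlib

open MeasureTheory
open scoped ENNReal ComplexConjugate

noncomputable section

/-- The dual group carries its Borel `σ`-algebra. -/
instance PontryaginDual.instMeasurableSpaceBorel (Γ : Type*) [Monoid Γ] [TopologicalSpace Γ] :
    MeasurableSpace (PontryaginDual Γ) := borel _

instance PontryaginDual.instBorelSpace (Γ : Type*) [Monoid Γ] [TopologicalSpace Γ] :
    BorelSpace (PontryaginDual Γ) := ⟨rfl⟩

set_option linter.unusedSectionVars false

variable {Γ : Type*} [CommGroup Γ] [TopologicalSpace Γ] [DiscreteTopology Γ]

/-- The dual endomorphism `α*` of the dual group, `(α* ω)(γ) = ω (α γ)`. -/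
def dualEnd (α : Γ →* Γ) : PontryaginDual Γ →ₜ* PontryaginDual Γ :=
  PontryaginDual.map ⟨α, continuous_of_discreteTopology⟩

theorem dualEnd_apply (α : Γ →* Γ) (ω : PontryaginDual Γ) (γ : Γ) :
    dualEnd α ω γ = ω (α γ) := rfl

/-- `α` is an isomorphism of `Γ` into itself, its image has finite index `N > 1`, and the images of
its iterates have trivial intersection. (`Subgroup.index` is `0` for infinite index.) -/
structure IsDilation (α : Γ →* Γ) : Prop where
  injective : Function.Injective α
  one_lt_index : 1 < α.range.index
  iInter_range : ⋂ n : ℕ, Set.range (α^[n]) = {1}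

theorem circle_baer : Module.Baer ℤ (Additive Circle) := by
  have e : AddCircle (1 : ℝ) ≃+ Additive Circle :=
    { toFun := fun x => Additive.ofMul (AddCircle.homeomorphCircle one_ne_zero x)
      invFun := fun x => (AddCircle.homeomorphCircle one_ne_zero).symm x.toMul
      left_inv := fun x => by simp
      right_inv := fun x => by simp
      map_add' := fun x y => by
        simp only [AddCircle.homeomorphCircle_apply]
        rw [AddCircle.toCircle_add]; rfl }
  exact Module.Baer.of_equiv e.toIntLinearEquiv (Module.Baer.of_divisible _)

theorem dualEnd_surjective {α : Γ →* Γ} (hα : IsDilation α) :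
    Function.Surjective (dualEnd α) := by
  intro χ
  obtain ⟨h, hh⟩ := circle_baer.extension_property_addMonoidHom (MonoidHom.toAdditive α)
    hα.injective (MonoidHom.toAdditive (χ : Γ →* Circle))
  refine ⟨(⟨MonoidHom.toAdditive.symm h, continuous_of_discreteTopology⟩ : Γ →ₜ* Circle), ?_⟩
  apply PontryaginDual.ext
  intro a
  exact congrArg Additive.toMul (DFunLike.congr_fun hh (Additive.ofMul a))

theorem dualEnd_measurePreserving {α : Γ →* Γ} (hα : IsDilation α)
    (μ : Measure (PontryaginDual Γ)) [μ.IsHaarMeasure] :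
    MeasurePreserving (dualEnd α) μ μ :=
  MonoidHom.measurePreserving (f := (dualEnd α : PontryaginDual Γ →* PontryaginDual Γ))
    (dualEnd α).continuous_toFun (dualEnd_surjective hα) rfl

/-- The kernel of `α*`. -/
abbrev dualKer (α : Γ →* Γ) : Type _ := {κ : PontryaginDual Γ // dualEnd α κ = 1}

/-- The kernel of `α*` is the dual of the finite group `Γ / α(Γ)`. -/
def dualKerEquiv (α : Γ →* Γ) : dualKer α ≃ (Γ ⧸ α.range →* Circle) where
  toFun κ := QuotientGroup.lift α.range (κ.1 : Γ →* Circle) (by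
    rintro _ ⟨γ, rfl⟩
    exact DFunLike.congr_fun κ.2 γ)
  invFun φ := ⟨(⟨φ.comp (QuotientGroup.mk' _), continuous_of_discreteTopology⟩ : Γ →ₜ* Circle), by
    apply PontryaginDual.ext
    intro γ
    change φ (QuotientGroup.mk (α γ)) = 1
    have h1 : (QuotientGroup.mk (α γ) : Γ ⧸ α.range) = 1 :=
      (QuotientGroup.eq_one_iff (α γ)).2 (MonoidHom.mem_range.2 ⟨γ, rfl⟩)
    rw [h1, map_one]⟩
  left_inv κ := rfl
  right_inv φ := by ext x; rfl

theorem card_dualKer {α : Γ →* Γ} (hα : IsDilation α) : Nat.card (dualKer α) = α.range.index := by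
  have h0 : α.range.index ≠ 0 := by have := hα.one_lt_index; omega
  have : Finite (Γ ⧸ α.range) := by
    have : α.range.FiniteIndex := ⟨h0⟩
    infer_instance
  have : NeZero (Monoid.exponent (Γ ⧸ α.range)) :=
    ⟨Monoid.exponent_ne_zero_of_finite⟩
  rw [Nat.card_congr (dualKerEquiv α), 
    Nat.card_congr ((toUnits (G := Circle)).monoidHomCongrRight (M := Γ ⧸ α.range)).toEquiv,
    CommGroup.card_monoidHom_of_hasEnoughRootsOfUnity]
  rfl

/-- The sum of `φ ζ` over all `ζ` with `α* ζ = ω`. Under `IsDilation α` each fiber has exactly `N`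
elements, see `fiberSum_dualEnd` and `card_dualKer`. -/
def fiberSum {M : Type*} [AddCommMonoid M] (α : Γ →* Γ) (φ : PontryaginDual Γ → M)
    (ω : PontryaginDual Γ) : M :=
  ∑ᶠ ζ : {ζ : PontryaginDual Γ // dualEnd α ζ = ω}, φ ζ

theorem fiberSum_dualEnd {M : Type*} [AddCommMonoid M] (α : Γ →* Γ) [Fintype (dualKer α)]
    (φ : PontryaginDual Γ → M) (ω : PontryaginDual Γ) :
    fiberSum α φ (dualEnd α ω) = ∑ κ : dualKer α, φ (ω * κ) := by
  let e : dualKer α ≃ {ζ : PontryaginDual Γ // dualEnd α ζ = dualEnd α ω} :=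
    { toFun := fun κ => ⟨ω * κ, by rw [map_mul, κ.2, mul_one]⟩
      invFun := fun ζ => ⟨ω⁻¹ * ζ, by rw [map_mul, map_inv, ζ.2, inv_mul_cancel]⟩
      left_inv := fun κ => by ext; simp
      right_inv := fun ζ => by ext; simp }
  rw [fiberSum, ← finsum_comp_equiv e, finsum_eq_sum_of_fintype]
  rfl

/-- A multiplicity function: a Borel function with values in `{0, 1, 2, …}` satisfying the
consistency inequality (almost everywhere). -/
def IsMultiplicityFunction (μ : Measure (PontryaginDual Γ)) (α : Γ →* Γ)
    (m : PontryaginDual Γ → ℕ) : Prop :=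
  Measurable m ∧ ∀ᵐ ω ∂μ, m ω ≤ fiberSum α m ω

/-- The set where `m ω ≥ i + 1`. All indices are shifted by one: the index `i : ℕ` stands for the
`(i + 1)`-st coordinate, row or column. -/
def sigmaSet (m : PontryaginDual Γ → ℕ) (i : ℕ) : Set (PontryaginDual Γ) := {ω | i < m ω}

/-- A filter relative to `m` and `α*`: a (possibly infinite) matrix of Borel functions on the dual
group, the `j`-th column supported in `σ_j`, which satisfies the filter equation. As for all
objects attached to the `L²` spaces, supports and equations are meant almost everywhere. For
almost every `ζ` the sum over `j` has only finitely many nonzero terms. -/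
structure IsFilter (μ : Measure (PontryaginDual Γ)) (α : Γ →* Γ) (m : PontryaginDual Γ → ℕ)
    (H : PontryaginDual Γ → Matrix ℕ ℕ ℂ) : Prop where
  measurable : ∀ i j, Measurable fun ω => H ω i j
  support : ∀ i j, ∀ᵐ ω ∂μ, ω ∉ sigmaSet m j → H ω i j = 0
  filter_eq : ∀ i i', ∀ᵐ ω ∂μ,
    fiberSum α (fun ζ => ∑' j, H ζ i j * conj (H ζ i' j)) ω =
      (α.range.index : ℂ) * (if i = i' then 1 else 0) * (sigmaSet m i).indicator 1 ω

/-- The Hilbert space direct sum `⨁ᵢ L²(σ_i, μ)`. -/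
abbrev CoreSpace (μ : Measure (PontryaginDual Γ)) (m : PontryaginDual Γ → ℕ) : Type _ :=
  lp (fun i : ℕ => Lp ℂ 2 (μ.restrict (sigmaSet m i))) 2

/-- The `j`-th coordinate at `ω` of `H(ω)ᵗ f(α* ω)`. The coordinates of `f(α* ω)` beyond
`m (α* ω)` vanish since `f i` lives on `σ_i`. -/
def ruelleFun (α : Γ →* Γ) (m : PontryaginDual Γ → ℕ) (H : PontryaginDual Γ → Matrix ℕ ℕ ℂ)
    (f : ℕ → PontryaginDual Γ → ℂ) (j : ℕ) (ω : PontryaginDual Γ) : ℂ :=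
  ∑ i ∈ Finset.range (m (dualEnd α ω)), H ω i j * f i (dualEnd α ω)

variable {α : Γ →* Γ} {m : PontryaginDual Γ → ℕ} {H : PontryaginDual Γ → Matrix ℕ ℕ ℂ}
  {μ : Measure (PontryaginDual Γ)} 

theorem measurable_dualEnd (α : Γ →* Γ) : Measurable (dualEnd α) :=
  (dualEnd α).continuous_toFun.measurable

theorem measurableSet_sigmaSet (hm : Measurable m) (i : ℕ) : MeasurableSet (sigmaSet m i) :=
  hm measurableSet_Ioi

theorem measurable_ruelleFun (hm : Measurable m) (hH : ∀ i j, Measurable fun ω => H ω i j)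
    {f : ℕ → PontryaginDual Γ → ℂ} (hf : ∀ i, Measurable (f i)) (j : ℕ) :
    Measurable (ruelleFun α m H f j) := by
  let F : ℕ × PontryaginDual Γ → ℂ := fun p =>
    ∑ i ∈ Finset.range p.1, H p.2 i j * f i (dualEnd α p.2)
  have hF : Measurable F := measurable_from_prod_countable_right fun n =>
    Finset.measurable_fun_sum (Finset.range n) fun i _ =>
      (hH i j).mul ((hf i).comp (measurable_dualEnd α))
  exact hF.comp ((hm.comp (measurable_dualEnd α)).prodMk measurable_id)

theorem sum_norm_sq_matrix {K : Type*} [Fintype K] (M : ℕ) (d : K → ℕ) (N : ℂ)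
    (h : K → ℕ → ℕ → ℂ) (hd : ∀ κ i j, d κ ≤ j → h κ i j = 0)
    (hh : ∀ i < M, ∀ i' < M, ∑ κ, ∑' j, h κ i j * conj (h κ i' j) = if i = i' then N else 0)
    (v : ℕ → ℂ) :
    ∑ κ, ∑ j ∈ Finset.range (d κ),
        (((‖∑ i ∈ Finset.range M, h κ i j * v i‖ ^ 2 : ℝ)) : ℂ) =
      N * ∑ i ∈ Finset.range M, ((‖v i‖ ^ 2 : ℝ) : ℂ) := by
  have hh' : ∀ i < M, ∀ i' < M, ∑ κ, ∑ j ∈ Finset.range (d κ), h κ i j * conj (h κ i' j)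
      = if i = i' then N else 0 := by
    intro i hi i' hi'
    rw [← hh i hi i' hi']
    refine Finset.sum_congr rfl fun κ _ => ?_
    rw [tsum_eq_sum]
    intro j hj
    rw [hd κ i j (by simpa using hj), zero_mul]
  have key : ∀ κ j, (((‖∑ i ∈ Finset.range M, h κ i j * v i‖ ^ 2 : ℝ)) : ℂ) =
      ∑ i ∈ Finset.range M, ∑ i' ∈ Finset.range M,
        (v i * conj (v i')) * (h κ i j * conj (h κ i' j)) := by
    intro κ j
    push_cast
    rw [← Complex.mul_conj', map_sum, Finset.sum_mul_sum]
    refine Finset.sum_congr rfl fun i _ => Finset.sum_congr rfl fun i' _ => ?_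
    rw [map_mul]; ring
  simp_rw [key]
  calc _ = ∑ i ∈ Finset.range M, ∑ i' ∈ Finset.range M, (v i * conj (v i')) *
        ∑ κ, ∑ j ∈ Finset.range (d κ), h κ i j * conj (h κ i' j) := by
        simp_rw [Finset.mul_sum]
        rw [Finset.sum_congr rfl fun κ _ => Finset.sum_comm, Finset.sum_comm]
        refine Finset.sum_congr rfl fun i _ => ?_
        rw [Finset.sum_congr rfl fun κ _ => Finset.sum_comm, Finset.sum_comm]
    _ = ∑ i ∈ Finset.range M, (v i * conj (v i)) * N := by
        refine Finset.sum_congr rfl fun i hi => ?_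
        rw [Finset.sum_eq_single_of_mem i hi]
        · rw [hh' i (by simpa using hi) i (by simpa using hi), if_pos rfl]
        · intro i' hi' hne
          rw [hh' i (by simpa using hi) i' (by simpa using hi'), if_neg hne.symm, mul_zero]
    _ = _ := by
        rw [Finset.mul_sum]
        refine Finset.sum_congr rfl fun i _ => ?_
        rw [Complex.mul_conj']; push_cast; ring

theorem sum_enorm_sq_matrix {K : Type*} [Fintype K] (M : ℕ) (d : K → ℕ) (N : ℕ)
    (h : K → ℕ → ℕ → ℂ) (hd : ∀ κ i j, d κ ≤ j → h κ i j = 0)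
    (hh : ∀ i < M, ∀ i' < M, ∑ κ, ∑' j, h κ i j * conj (h κ i' j)
      = if i = i' then (N : ℂ) else 0)
    (v : ℕ → ℂ) :
    ∑ κ, ∑ j ∈ Finset.range (d κ), ‖∑ i ∈ Finset.range M, h κ i j * v i‖ₑ ^ 2 =
      (N : ℝ≥0∞) * ∑ i ∈ Finset.range M, ‖v i‖ₑ ^ 2 := by
  have h1 := sum_norm_sq_matrix M d N h hd hh v
  have h2 : ∑ κ, ∑ j ∈ Finset.range (d κ), ‖∑ i ∈ Finset.range M, h κ i j * v i‖ ^ 2 =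
      (N : ℝ) * ∑ i ∈ Finset.range M, ‖v i‖ ^ 2 := by exact_mod_cast h1
  have h3 : ∑ κ, ∑ j ∈ Finset.range (d κ), ‖∑ i ∈ Finset.range M, h κ i j * v i‖₊ ^ 2 =
      (N : NNReal) * ∑ i ∈ Finset.range M, ‖v i‖₊ ^ 2 := by
    apply NNReal.coe_injective
    push_cast
    exact h2
  simp only [enorm_eq_nnnorm]
  exact_mod_cast congrArg (fun x : NNReal => (x : ℝ≥0∞)) h3

theorem lintegral_ruelleFun (hα : IsDilation α) [μ.IsHaarMeasure] (hm : Measurable m)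
    (hH : IsFilter μ α m H) {f : ℕ → PontryaginDual Γ → ℂ} (hf : ∀ i, Measurable (f i)) :
    ∑' j, ∫⁻ ω in sigmaSet m j, ‖ruelleFun α m H f j ω‖ₑ ^ 2 ∂μ =
      ∑' i, ∫⁻ ω in sigmaSet m i, ‖f i ω‖ₑ ^ 2 ∂μ := by
  have hN : α.range.index ≠ 0 := by have := hα.one_lt_index; omega
  have hfin : Finite (dualKer α) := Nat.finite_of_card_ne_zero (by rwa [card_dualKer hα])
  have : Fintype (dualKer α) := Fintype.ofFinite _
  have hT := dualEnd_measurePreserving hα μ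
  have hσ := measurableSet_sigmaSet (Γ := Γ) hm
  have hS : ∀ j, Measurable fun ω => ‖ruelleFun α m H f j ω‖ₑ ^ 2 := fun j =>
    (measurable_ruelleFun hm hH.measurable hf j).enorm.pow_const 2
  have hF : ∀ j, Measurable fun ω => ‖f j ω‖ₑ ^ 2 := fun j => (hf j).enorm.pow_const 2
  -- the total mass of a sequence of functions at a point
  let D : (ℕ → PontryaginDual Γ → ℂ) → PontryaginDual Γ → ℝ≥0∞ := fun g ω =>
    ∑' j, (sigmaSet m j).indicator (fun ω => ‖g j ω‖ₑ ^ 2) ω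
  have hD : ∀ g : ℕ → PontryaginDual Γ → ℂ, (∀ j, Measurable fun ω => ‖g j ω‖ₑ ^ 2) →
      Measurable (D g) ∧ ∑' j, ∫⁻ ω in sigmaSet m j, ‖g j ω‖ₑ ^ 2 ∂μ = ∫⁻ ω, D g ω ∂μ := by
    intro g hg
    refine ⟨Measurable.tsum fun j => (hg j).indicator (hσ j), ?_⟩
    rw [lintegral_tsum fun j => ((hg j).indicator (hσ j)).aemeasurable]
    simp_rw [lintegral_indicator (hσ _)]
  have hDsum : ∀ g ω, D g ω = ∑ j ∈ Finset.range (m ω), ‖g j ω‖ₑ ^ 2 := by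
    intro g ω
    simp only [D]
    rw [tsum_eq_sum (s := Finset.range (m ω))]
    · refine Finset.sum_congr rfl fun j hj => Set.indicator_of_mem ?_ _
      simpa [sigmaSet] using hj
    · intro j hj
      exact Set.indicator_of_notMem (by simpa [sigmaSet] using hj) _
  have hpt : ∀ᵐ ω ∂μ, ∑ κ : dualKer α, D (ruelleFun α m H f) (ω * κ) =
      (α.range.index : ℝ≥0∞) * D f (dualEnd α ω) := by
    have h1 : ∀ᵐ ω ∂μ, ∀ κ : dualKer α, ∀ i j,
        ω * (κ : PontryaginDual Γ) ∉ sigmaSet m j → H (ω * κ) i j = 0 := by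
      rw [ae_all_iff]
      intro κ
      have := ae_all_iff.2 fun i => ae_all_iff.2 fun j => hH.support i j
      exact (measurePreserving_mul_right μ (κ : PontryaginDual Γ)).quasiMeasurePreserving.ae this
    have h2 := hT.quasiMeasurePreserving.ae
      (ae_all_iff.2 fun i => ae_all_iff.2 fun i' => hH.filter_eq i i')
    filter_upwards [h1, h2] with ω h1 h2
    have hk : ∀ κ : dualKer α, dualEnd α (ω * (κ : PontryaginDual Γ)) = dualEnd α ω := fun κ => by
      rw [map_mul, κ.2, mul_one]
    simp_rw [hDsum, ruelleFun, hk]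
    refine sum_enorm_sq_matrix (m (dualEnd α ω)) (fun κ : dualKer α => m (ω * (κ : PontryaginDual Γ)))
      α.range.index (fun κ i j => H (ω * κ) i j) ?_ ?_ (fun i => f i (dualEnd α ω))
    · intro κ i j hj
      exact h1 κ i j (by simpa [sigmaSet] using hj)
    · intro i hi i' _
      have := h2 i i'
      rw [fiberSum_dualEnd, Set.indicator_of_mem (show dualEnd α ω ∈ sigmaSet m i from hi)] at this
      rw [this]
      split_ifs <;> simp
  obtain ⟨hD1, hD2⟩ := hD _ hS
  obtain ⟨hD3, hD4⟩ := hD _ hF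
  rw [hD2, hD4]
  have h3 : ∫⁻ ω, ∑ κ : dualKer α, D (ruelleFun α m H f) (ω * κ) ∂μ =
      (α.range.index : ℝ≥0∞) * ∫⁻ ω, D (ruelleFun α m H f) ω ∂μ := by
    rw [lintegral_finsetSum (f := fun (κ : dualKer α) ω => D (ruelleFun α m H f) (ω * κ)) _
      fun κ _ => hD1.comp (measurable_mul_const _)]
    simp_rw [lintegral_mul_right_eq_self]
    rw [Finset.sum_const, nsmul_eq_mul, Finset.card_univ, ← Nat.card_eq_fintype_card,
      card_dualKer hα]
  rw [lintegral_congr_ae hpt, 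
    lintegral_const_mul (f := fun ω => D f (dualEnd α ω)) _ (hD3.comp (measurable_dualEnd α)),
    hT.lintegral_comp hD3] at h3
  exact ((ENNReal.mul_right_inj (by exact_mod_cast hN) (ENNReal.natCast_ne_top _)).1 h3).symm

theorem Lp_enorm_sq {X : Type*} [MeasurableSpace X] {ν : Measure X} (g : Lp ℂ 2 ν) :
    ‖g‖ₑ ^ 2 = ∫⁻ x, ‖g x‖ₑ ^ 2 ∂ν := by
  rw [Lp.enorm_def]
  have := eLpNorm_nnreal_pow_eq_lintegral (f := g) (μ := ν) (p := 2) two_ne_zero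
  simpa using this

theorem memℓp_two_iff {E : ℕ → Type*} [∀ i, NormedAddCommGroup (E i)] (F : ∀ i, E i) :
    Memℓp F 2 ↔ ∑' i, ‖F i‖ₑ ^ 2 ≠ ∞ := by
  rw [memℓp_gen_iff (by simp)]
  have := ENNReal.tsum_coe_ne_top_iff_summable_coe (f := fun i => ‖F i‖₊ ^ 2)
  simpa [enorm_eq_nnnorm] using this.symm

theorem lp_two_enorm_sq {E : ℕ → Type*} [∀ i, NormedAddCommGroup (E i)] (F : lp E 2) :
    ‖F‖ₑ ^ 2 = ∑' i, ‖F i‖ₑ ^ 2 := by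
  have h := lp.norm_rpow_eq_tsum (by simp) F
  have hs := (memℓp_gen_iff (by simp)).1 (lp.memℓp F)
  simp only [ENNReal.toReal_ofNat, Real.rpow_ofNat] at h hs
  rw [← ofReal_norm, ← ENNReal.ofReal_pow (norm_nonneg _), h,
    ENNReal.ofReal_tsum_of_nonneg (fun i => by positivity) hs]
  refine tsum_congr fun i => ?_
  rw [← ofReal_norm, ← ENNReal.ofReal_pow (norm_nonneg _)]

theorem memLp_ruelleFun (hα : IsDilation α) [μ.IsHaarMeasure] (hm : Measurable m)
    (hH : IsFilter μ α m H) (f : CoreSpace μ m) (j : ℕ) :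
    MemLp (ruelleFun α m H (fun i => f i) j) 2 (μ.restrict (sigmaSet m j)) := by
  have hf : ∀ i, Measurable (f i) := fun i => (Lp.stronglyMeasurable (f i)).measurable
  refine ⟨(measurable_ruelleFun hm hH.measurable hf j).aestronglyMeasurable, ?_⟩
  have h1 := lintegral_ruelleFun hα hm hH hf
  simp_rw [← Lp_enorm_sq] at h1
  have h2 := (memℓp_two_iff _).1 (lp.memℓp f)
  rw [← h1] at h2
  have h3 := ENNReal.ne_top_of_tsum_ne_top h2 j
  have h4 := eLpNorm_nnreal_pow_eq_lintegral (f := ruelleFun α m H (fun i => f i) j)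
    (μ := μ.restrict (sigmaSet m j)) (p := 2) two_ne_zero
  simp only [NNReal.coe_ofNat, ENNReal.rpow_ofNat, ENNReal.coe_ofNat] at h4
  rw [← h4] at h3
  exact lt_top_iff_ne_top.2 fun h => h3 (by rw [h]; simp)

/-- The `j`-th coordinate of `S_H f`, as an element of `L²(σ_j)`. -/
def ruelleCoord (hα : IsDilation α) [μ.IsHaarMeasure] (hm : Measurable m)
    (hH : IsFilter μ α m H) (f : CoreSpace μ m) (j : ℕ) :
    Lp ℂ 2 (μ.restrict (sigmaSet m j)) :=
  (memLp_ruelleFun hα hm hH f j).toLp _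

theorem ruelleCoord_ae (hα : IsDilation α) [μ.IsHaarMeasure] (hm : Measurable m)
    (hH : IsFilter μ α m H) (f : CoreSpace μ m) (j : ℕ) :
    ruelleCoord hα hm hH f j =ᵐ[μ.restrict (sigmaSet m j)]
      ruelleFun α m H (fun i => f i) j :=
  MemLp.coeFn_toLp _

theorem tsum_enorm_ruelleCoord (hα : IsDilation α) [μ.IsHaarMeasure] (hm : Measurable m)
    (hH : IsFilter μ α m H) (f : CoreSpace μ m) :
    ∑' j, ‖ruelleCoord hα hm hH f j‖ₑ ^ 2 = ∑' i, ‖f i‖ₑ ^ 2 := by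
  have hf : ∀ i, Measurable (f i) := fun i => (Lp.stronglyMeasurable (f i)).measurable
  simp_rw [Lp_enorm_sq]
  rw [← lintegral_ruelleFun hα hm hH hf]
  refine tsum_congr fun j => lintegral_congr_ae ?_
  filter_upwards [ruelleCoord_ae hα hm hH f j] with ω h
  rw [h]

theorem ruelleFun_congr_ae (hα : IsDilation α) [μ.IsHaarMeasure] (hm : Measurable m)
    {f g : ℕ → PontryaginDual Γ → ℂ} (h : ∀ i, f i =ᵐ[μ.restrict (sigmaSet m i)] g i) (j : ℕ) :
    ruelleFun α m H f j =ᵐ[μ] ruelleFun α m H g j := by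
  have h1 := ae_all_iff.2 fun i => (ae_restrict_iff' (measurableSet_sigmaSet hm i)).1 (h i)
  filter_upwards [(dualEnd_measurePreserving hα μ).quasiMeasurePreserving.ae h1] with ω hω
  refine Finset.sum_congr rfl fun i hi => ?_
  rw [hω i (by simpa [sigmaSet] using hi)]

/-- The Ruelle operator `S_H` on `⨁ᵢ L²(σ_i)`, `(S_H f)(ω) = H(ω)ᵗ f(α* ω)`. It is an isometry. -/
def ruelle (hα : IsDilation α) [μ.IsHaarMeasure] (hm : Measurable m) (hH : IsFilter μ α m H) :
    CoreSpace μ m →ₗᵢ[ℂ] CoreSpace μ m where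
  toFun f := ⟨ruelleCoord hα hm hH f, (memℓp_two_iff _).2 (by
    rw [tsum_enorm_ruelleCoord]; exact (memℓp_two_iff _).1 (lp.memℓp f))⟩
  map_add' f g := by
    refine lp.ext (funext fun j => Lp.ext ?_)
    change ruelleCoord hα hm hH (f + g) j =ᵐ[_]
      (ruelleCoord hα hm hH f j + ruelleCoord hα hm hH g j : Lp ℂ 2 _)
    have h := ruelleFun_congr_ae (H := H) hα hm (f := fun i => (f + g) i)
      (g := fun i => f i + g i) (fun i => Lp.coeFn_add (f i) (g i)) j
    filter_upwards [ruelleCoord_ae hα hm hH (f + g) j, ruelleCoord_ae hα hm hH f j,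
      ruelleCoord_ae hα hm hH g j, ae_restrict_of_ae h,
      Lp.coeFn_add (ruelleCoord hα hm hH f j) (ruelleCoord hα hm hH g j)] with ω h1 h2 h3 h4 h5
    rw [h1, h4, h5, Pi.add_apply, h2, h3]
    simp only [ruelleFun, Pi.add_apply, mul_add, Finset.sum_add_distrib]
  map_smul' c f := by
    refine lp.ext (funext fun j => Lp.ext ?_)
    change ruelleCoord hα hm hH (c • f) j =ᵐ[_] (c • ruelleCoord hα hm hH f j : Lp ℂ 2 _)
    have h := ruelleFun_congr_ae (H := H) hα hm (f := fun i => (c • f) i)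
      (g := fun i => c • f i) (fun i => Lp.coeFn_smul c (f i)) j
    filter_upwards [ruelleCoord_ae hα hm hH (c • f) j, ruelleCoord_ae hα hm hH f j,
      ae_restrict_of_ae h, Lp.coeFn_smul c (ruelleCoord hα hm hH f j)] with ω h1 h2 h4 h5
    rw [h1, h4, h5, Pi.smul_apply, h2]
    simp only [ruelleFun, Pi.smul_apply, smul_eq_mul, Finset.mul_sum, mul_left_comm]
  norm_map' f := by
    have h := lp_two_enorm_sq (E := fun i : ℕ => Lp ℂ 2 (μ.restrict (sigmaSet m i)))
      ⟨ruelleCoord hα hm hH f, (memℓp_two_iff _).2 (by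
        rw [tsum_enorm_ruelleCoord]; exact (memℓp_two_iff _).1 (lp.memℓp f))⟩
    have h' := h.trans ((tsum_enorm_ruelleCoord hα hm hH f).trans (lp_two_enorm_sq f).symm)
    have h2 := congrArg ENNReal.toReal h'
    simp only [ENNReal.toReal_pow, toReal_enorm] at h2
    exact (pow_left_inj₀ (norm_nonneg _) (norm_nonneg _) two_ne_zero).1 h2

/-- The defining formula of the Ruelle operator. -/
theorem ruelle_apply_ae (hα : IsDilation α) [μ.IsHaarMeasure] (hm : Measurable m)
    (hH : IsFilter μ α m H) (f : CoreSpace μ m) (j : ℕ) :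
    ruelle hα hm hH f j =ᵐ[μ.restrict (sigmaSet m j)] fun ω =>
      ∑ i ∈ Finset.range (m (dualEnd α ω)), H ω i j * f i (dualEnd α ω) :=
  ruelleCoord_ae hα hm hH f j

/-- An isometry is pure if the ranges of its powers have trivial intersection, i.e. if it has no
unitary part. -/
def IsPureIsometry {E : Type*} [NormedAddCommGroup E] [NormedSpace ℂ E] (S : E →ₗᵢ[ℂ] E) : Prop :=
  ⋂ n : ℕ, Set.range (S^[n]) = {0}

/-- A Borel matrix-valued function `A` such that `A ω` is a unitary matrix of dimension `m ω` in the
upper left corner, and zero elsewhere. -/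
structure IsUnitaryField (m : PontryaginDual Γ → ℕ) (A : PontryaginDual Γ → Matrix ℕ ℕ ℂ) :
    Prop where
  measurable : ∀ i j, Measurable fun ω => A ω i j
  zero : ∀ ω i j, m ω ≤ i ∨ m ω ≤ j → A ω i j = 0
  unitary : ∀ ω, (A ω).submatrix (Fin.val : Fin (m ω) → ℕ) (Fin.val : Fin (m ω) → ℕ) ∈
    Matrix.unitaryGroup (Fin (m ω)) ℂ

/-- `H` and `H'` are equivalent: `H'(ω) = A(α* ω) H(ω) A(ω)*` for almost all `ω`, for some `A` as
above. The sums are finite because of the block structure of `A`. -/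
def FilterEquiv (μ : Measure (PontryaginDual Γ)) (α : Γ →* Γ) (m : PontryaginDual Γ → ℕ)
    (H H' : PontryaginDual Γ → Matrix ℕ ℕ ℂ) : Prop :=
  ∃ A : PontryaginDual Γ → Matrix ℕ ℕ ℂ, IsUnitaryField m A ∧
    ∀ᵐ ω ∂μ, ∀ i j, H' ω i j =
      ∑ k ∈ Finset.range (m (dualEnd α ω)), ∑ l ∈ Finset.range (m ω),
        A (dualEnd α ω) i k * H ω k l * conj (A ω j l)

/-- An eigenfilter: a filter whose first row is almost everywhere `(c, 0, 0, …)` for a constant `c` of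
modulus one. -/
structure IsEigenfilter (μ : Measure (PontryaginDual Γ)) (α : Γ →* Γ) (m : PontryaginDual Γ → ℕ)
    (H : PontryaginDual Γ → Matrix ℕ ℕ ℂ) : Prop extends IsFilter μ α m H where
  exists_eigenvalue : ∃ c : ℂ, ‖c‖ = 1 ∧ ∀ᵐ ω ∂μ, H ω 0 0 = c ∧ ∀ j, 0 < j → H ω 0 j = 0

end

/-! Write `⟨f, g⟩(ω)` for the inner product of the values of `f` and `g` at `ω`. The filter equation
says that averaging `⟨S_H f, S_H g⟩` over the fibers of `α*` gives back `⟨f, g⟩`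
(`isFiberMean_fiberInner_ruelle`). On the other hand `α*` is exact: because the groups `α^n(Γ)`
intersect trivially, iterated fiber means of any integrable function converge in `L¹` to a constant
(`tendsto_integral_norm_sub_of_isFiberMean`).

Let `v_1, …, v_k` be independent in the intersection of the ranges, `v_i = S_H^n y_{n,i}`. The
pointwise Gram matrices of the `y_{n,i}` converge, almost everywhere along a subsequence, to a
positive multiple of the Gram matrix of the `v_i`, which is invertible. At `ω` they have rank at
most `m(ω)`, so `k ≤ m(ω)` and the intersection is finite dimensional
(`finiteDimensional_iInfRange_ruelle`). If it is nonzero, it contains an eigenvector `f` with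
eigenvalue `c` of modulus one. The preimages `c^{-n} f` all have the same pointwise norm as `f`, so
this norm is constant, and it can be scaled to `1` (`exists_fiberwise_unit_eigenvector`).

A Householder reflection completes `f(ω)` measurably to a unitary matrix `A(ω)` with first row
`f(ω)`. The first row of `A(α* ω) H(ω) A(ω)*` is then `(S_H f)(ω)ᵗ A(ω)* = c f(ω)ᵗ A(ω)* = (c, 0, 0,
…)`. Conversely, if `A` carries `H` to an eigenfilter, the first row of `A` is an eigenvector of
`S_H`, and an eigenvector lies in the range of every power. -/

theorem IsDilation.index_ne_zero {Γ : Type*} [CommGroup Γ] {α : Γ →* Γ} (hα : IsDilation α) :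
    α.range.index ≠ 0 := by
  have := hα.one_lt_index
  omega

/-! ### Null sets, means over the fibers of `α*`, and characters of its kernel -/

section DualGroup

set_option linter.unusedSectionVars false

variable {Γ : Type*} [CommGroup Γ] [TopologicalSpace Γ] [DiscreteTopology Γ] {α : Γ →* Γ}
  {μ : Measure (PontryaginDual Γ)}

/-- Second countability supplies the regularity of Haar measure behind the approximations by open
sets and by continuous functions. -/
instance PontryaginDual.secondCountableTopology [Countable Γ] :
    SecondCountableTopology (PontryaginDual Γ) :=
  (ContinuousMonoidHom.isInducing_toContinuousMap Γ Circle).secondCountableTopology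

theorem IsDilation.finite_dualKer (hα : IsDilation α) : Finite (dualKer α) := by
  have := hα.one_lt_index
  exact Nat.finite_of_card_ne_zero (by rw [card_dualKer hα]; omega)

theorem isOpenMap_dualEnd (hα : IsDilation α) : IsOpenMap (dualEnd α) :=
  MonoidHom.isOpenMap_of_sigmaCompact (dualEnd α : PontryaginDual Γ →* PontryaginDual Γ)
    (dualEnd_surjective hα) (dualEnd α).continuous_toFun

theorem preimage_image_dualEnd (s : Set (PontryaginDual Γ)) :
    dualEnd α ⁻¹' (dualEnd α '' s) =
      ⋃ κ : dualKer α, (fun ω => ω * (κ : PontryaginDual Γ)) ⁻¹' s := by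
  ext ω
  simp only [Set.mem_preimage, Set.mem_image, Set.mem_iUnion]
  constructor
  · rintro ⟨ζ, hζ, h⟩
    exact ⟨⟨ω⁻¹ * ζ, by rw [map_mul, map_inv, h, inv_mul_cancel]⟩, by simpa using hζ⟩
  · rintro ⟨κ, hκ⟩
    exact ⟨_, hκ, by rw [map_mul, κ.2, mul_one]⟩

/-- The image of a null set under `α*` is a null set. -/
theorem measure_image_dualEnd_eq_zero [Countable Γ] (hα : IsDilation α) [μ.IsHaarMeasure]
    {s : Set (PontryaginDual Γ)} (hs : μ s = 0) : μ (dualEnd α '' s) = 0 := by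
  have := hα.finite_dualKer
  have := Fintype.ofFinite (dualKer α)
  have hN : (Fintype.card (dualKer α) : ℝ≥0∞) ≠ 0 := by
    rw [← Nat.card_eq_fintype_card, card_dualKer hα]
    exact_mod_cast hα.index_ne_zero
  by_contra h0
  -- If the image had positive measure, `s` would lie in an open `U` of measure below `1/N` of it.
  -- But `α*(U)` is open and its preimage is a union of `N` translates of `U`.
  obtain ⟨U, hsU, hU, hμU⟩ := s.exists_isOpen_lt_of_lt (μ := μ)
    (μ (dualEnd α '' s) / Fintype.card (dualKer α))
    (by rw [hs]; exact ENNReal.div_pos h0 (ENNReal.natCast_ne_top _))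
  refine lt_irrefl (μ (dualEnd α '' s)) ?_
  calc μ (dualEnd α '' s) ≤ μ (dualEnd α '' U) := measure_mono (Set.image_mono hsU)
    _ = μ (dualEnd α ⁻¹' (dualEnd α '' U)) :=
        ((dualEnd_measurePreserving hα μ).measure_preimage
          ((isOpenMap_dualEnd hα) U hU).measurableSet.nullMeasurableSet).symm
    _ ≤ ∑ κ : dualKer α, μ ((fun ω => ω * (κ : PontryaginDual Γ)) ⁻¹' U) := by
        rw [preimage_image_dualEnd]
        exact measure_iUnion_fintype_le _ _
    _ = μ U * Fintype.card (dualKer α) := by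
        simp [measure_preimage_mul_right, mul_comm]
    _ < μ (dualEnd α '' s) := by
        rwa [ENNReal.lt_div_iff_mul_lt (Or.inl hN) (Or.inl (ENNReal.natCast_ne_top _))] at hμU

/-- The set where `p` fails need not be measurable, so the argument rests on `α*` being onto and
sending null sets to null sets. -/
theorem ae_of_ae_dualEnd [Countable Γ] (hα : IsDilation α) [μ.IsHaarMeasure]
    {p : PontryaginDual Γ → Prop} (h : ∀ᵐ ω ∂μ, p (dualEnd α ω)) : ∀ᵐ ω ∂μ, p ω := by
  have h1 := measure_image_dualEnd_eq_zero hα (ae_iff.1 h)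
  refine measure_mono_null (fun ω hω => ?_) h1
  obtain ⟨ζ, rfl⟩ := dualEnd_surjective hα ω
  exact ⟨ζ, hω, rfl⟩

theorem ae_mul_dualKer (hα : IsDilation α) [μ.IsHaarMeasure]
    {p : PontryaginDual Γ → Prop} (h : ∀ᵐ ω ∂μ, p ω) :
    ∀ᵐ ω ∂μ, ∀ κ : dualKer α, p (ω * κ) := by
  have := hα.finite_dualKer
  exact ae_all_iff.2 fun κ =>
    (measurePreserving_mul_right μ (κ : PontryaginDual Γ)).quasiMeasurePreserving.ae h

/-- `h'` is (almost everywhere) the mean of `h` over the fibers of `α*`. -/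
def IsFiberMean (μ : Measure (PontryaginDual Γ)) (α : Γ →* Γ) [Fintype (dualKer α)]
    (h h' : PontryaginDual Γ → ℂ) : Prop :=
  ∀ᵐ ω ∂μ, ∑ κ : dualKer α, h (ω * κ) = α.range.index * h' (dualEnd α ω)

namespace IsFiberMean

variable [Fintype (dualKer α)] {h h' k k' : PontryaginDual Γ → ℂ}

theorem add (hh : IsFiberMean μ α h h') (hk : IsFiberMean μ α k k') :
    IsFiberMean μ α (fun ω => h ω + k ω) (fun ω => h' ω + k' ω) := by
  filter_upwards [hh, hk] with ω h1 h2
  rw [Finset.sum_add_distrib, h1, h2, mul_add]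

theorem const_mul (c : ℂ) (hh : IsFiberMean μ α h h') :
    IsFiberMean μ α (fun ω => c * h ω) (fun ω => c * h' ω) := by
  filter_upwards [hh] with ω h1
  rw [← Finset.mul_sum, h1, mul_left_comm]

theorem sub (hh : IsFiberMean μ α h h') (hk : IsFiberMean μ α k k') :
    IsFiberMean μ α (fun ω => h ω - k ω) (fun ω => h' ω - k' ω) := by
  filter_upwards [hh, hk] with ω h1 h2
  rw [Finset.sum_sub_distrib, h1, h2, mul_sub]

/-- Translation invariance turns the integral of the fiber sum into `N` times that of `h`;
invariance under `α*` handles the other side. -/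
theorem integral_eq (hα : IsDilation α) [μ.IsHaarMeasure] (hh : IsFiberMean μ α h h')
    (hi : Integrable h μ) (hi' : Integrable h' μ) : ∫ ω, h' ω ∂μ = ∫ ω, h ω ∂μ := by
  have hT := dualEnd_measurePreserving hα μ
  have hN : (α.range.index : ℂ) ≠ 0 := by exact_mod_cast hα.index_ne_zero
  refine mul_left_cancel₀ hN ?_
  rw [← integral_const_mul]
  nth_rw 1 [← hT.map_eq]
  rw [integral_map hT.measurable.aemeasurable
    (by rw [hT.map_eq]; exact (hi'.const_mul _).aestronglyMeasurable),
    ← integral_congr_ae hh, integral_finsetSum _ fun κ _ => hi.comp_mul_right _]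
  simp_rw [integral_mul_right_eq_self h]
  simp [← card_dualKer hα]

/-- Averaging is an `L¹` contraction, by the triangle inequality within each fiber. Hence
approximation errors do not grow under iteration. -/
theorem integral_norm_le (hα : IsDilation α) [μ.IsHaarMeasure] (hh : IsFiberMean μ α h h')
    (hi : Integrable h μ) (hi' : Integrable h' μ) : ∫ ω, ‖h' ω‖ ∂μ ≤ ∫ ω, ‖h ω‖ ∂μ := by
  have hT := dualEnd_measurePreserving hα μ
  have hN : (0 : ℝ) < α.range.index := by exact_mod_cast hα.index_ne_zero.bot_lt
  refine le_of_mul_le_mul_left ?_ hN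
  have e : ∀ᵐ ω ∂μ, (α.range.index : ℝ) * ‖h' (dualEnd α ω)‖ = ‖∑ κ : dualKer α, h (ω * κ)‖ := by
    filter_upwards [hh] with ω h1
    rw [h1, norm_mul, Complex.norm_natCast]
  have hc : ∀ κ : dualKer α, Integrable (fun ω => h (ω * κ)) μ := fun κ => hi.comp_mul_right _
  calc (α.range.index : ℝ) * ∫ ω, ‖h' ω‖ ∂μ
      = ∫ ω, (α.range.index : ℝ) * ‖h' (dualEnd α ω)‖ ∂μ := by
        rw [← integral_const_mul]
        nth_rw 1 [← hT.map_eq]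
        rw [integral_map hT.measurable.aemeasurable
          (by rw [hT.map_eq]; exact (hi'.norm.const_mul _).aestronglyMeasurable)]
    _ = ∫ ω, ‖∑ κ : dualKer α, h (ω * κ)‖ ∂μ := integral_congr_ae e
    _ ≤ ∫ ω, ∑ κ : dualKer α, ‖h (ω * κ)‖ ∂μ := by
        refine integral_mono (integrable_finsetSum _ fun κ _ => hc κ).norm
          (integrable_finsetSum _ fun κ _ => (hc κ).norm) fun ω => norm_sum_le _ _
    _ = (α.range.index : ℝ) * ∫ ω, ‖h ω‖ ∂μ := by
        rw [integral_finsetSum _ fun κ _ => (hc κ).norm]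
        simp_rw [integral_mul_right_eq_self (fun ω => ‖h ω‖)]
        simp [← card_dualKer hα]

end IsFiberMean

/-- Evaluation at `γ` as a continuous function on the dual group. -/
noncomputable def PontryaginDual.evalCM (γ : Γ) : C(PontryaginDual Γ, ℂ) where
  toFun ω := (ω γ : Circle)
  continuous_toFun := by
    exact continuous_subtype_val.comp ((ContinuousEvalConst.continuous_eval_const (F := C(Γ, Circle)) γ).comp
      (ContinuousMonoidHom.isInducing_toContinuousMap Γ Circle).continuous)

theorem PontryaginDual.evalCM_apply (γ : Γ) (ω : PontryaginDual Γ) :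
    PontryaginDual.evalCM γ ω = (ω γ : Circle) := rfl

/-- Characters of the finite group `Γ / α(Γ)` separate its points. -/
theorem exists_dualKer_apply_ne_one (hα : IsDilation α) {γ : Γ} (hγ : γ ∉ α.range) :
    ∃ κ : dualKer α, (κ : PontryaginDual Γ) γ ≠ 1 := by
  have : α.range.FiniteIndex := ⟨hα.index_ne_zero⟩
  have : Finite (Γ ⧸ α.range) := inferInstance
  have : NeZero (Monoid.exponent (Γ ⧸ α.range)) := ⟨Monoid.exponent_ne_zero_of_finite⟩
  have h1 : (QuotientGroup.mk γ : Γ ⧸ α.range) ≠ 1 := fun h =>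
    hγ ((QuotientGroup.eq_one_iff γ).1 h)
  obtain ⟨φ, hφ⟩ := CommGroup.exists_apply_ne_one_of_hasEnoughRootsOfUnity (Γ ⧸ α.range) Circle h1
  refine ⟨(dualKerEquiv α).symm ((toUnits (G := Circle)).symm.toMonoidHom.comp φ), fun h => hφ ?_⟩
  exact (toUnits (G := Circle)).symm.injective (h.trans (map_one _).symm)

/-- Orthogonality of characters: the shift `κ ↦ κ₀ κ` permutes the kernel and multiplies the sum by
`κ₀ γ ≠ 1`. -/
theorem sum_dualKer_apply_eq_zero [Fintype (dualKer α)] (hα : IsDilation α) {γ : Γ}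
    (hγ : γ ∉ α.range) : ∑ κ : dualKer α, (((κ : PontryaginDual Γ) γ : Circle) : ℂ) = 0 := by
  obtain ⟨κ₀, h0⟩ := exists_dualKer_apply_ne_one hα hγ
  let e : dualKer α ≃ dualKer α :=
    { toFun := fun κ => ⟨κ₀ * κ, by rw [map_mul, κ.2, κ₀.2, mul_one]⟩
      invFun := fun κ => ⟨(κ₀ : PontryaginDual Γ)⁻¹ * κ, by
        rw [map_mul, map_inv, κ.2, κ₀.2, inv_one, mul_one]⟩
      left_inv := fun κ => by ext; simp
      right_inv := fun κ => by ext; simp }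
  set S := ∑ κ : dualKer α, (((κ : PontryaginDual Γ) γ : Circle) : ℂ) with hS
  have h1 : (((κ₀ : PontryaginDual Γ) γ : Circle) : ℂ) * S = S := by
    conv_rhs => rw [hS, ← Equiv.sum_comp e]
    rw [hS, Finset.mul_sum]
    rfl
  have h2 : ((((κ₀ : PontryaginDual Γ) γ : Circle) : ℂ) - 1) * S = 0 := by
    rw [sub_mul, h1, one_mul, sub_self]
  refine (mul_eq_zero.1 h2).resolve_left fun h3 => h0 ?_
  exact Circle.coe_injective (by rw [sub_eq_zero.1 h3, Circle.coe_one])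

end DualGroup

/-! ### Exactness of `α*`: iterated fiber means converge to constants -/

section Exactness

set_option linter.unusedSectionVars false

variable {Γ : Type*} [CommGroup Γ] [TopologicalSpace Γ] [DiscreteTopology Γ] {α : Γ →* Γ}
  {μ : Measure (PontryaginDual Γ)}

namespace PontryaginDual

/-- The star subalgebra of continuous functions spanned by the evaluations. -/
noncomputable def trigPoly (Γ : Type*) [CommGroup Γ] [TopologicalSpace Γ] [DiscreteTopology Γ] :
    StarSubalgebra ℂ C(PontryaginDual Γ, ℂ) where
  toSubalgebra := Algebra.adjoin ℂ (Set.range evalCM)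
  star_mem' := by
    change Algebra.adjoin ℂ (Set.range (evalCM (Γ := Γ))) ≤
      star (Algebra.adjoin ℂ (Set.range (evalCM (Γ := Γ))))
    refine Algebra.adjoin_le ?_
    rintro - ⟨γ, rfl⟩
    refine Algebra.subset_adjoin ⟨γ⁻¹, ContinuousMap.ext fun ω => ?_⟩
    change ((ω γ⁻¹ : Circle) : ℂ) = conj ((ω γ : Circle) : ℂ)
    rw [map_inv, Circle.coe_inv_eq_conj]

theorem toSubmodule_trigPoly :
    Subalgebra.toSubmodule (trigPoly Γ).toSubalgebra = Submodule.span ℂ (Set.range evalCM) := by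
  apply Algebra.adjoin_eq_span_of_subset
  refine Set.Subset.trans ?_ Submodule.subset_span
  intro x hx
  refine Submonoid.closure_induction (fun _ => id) ⟨1, ?_⟩ ?_ hx
  · ext ω
    simp [evalCM_apply]
  · rintro - - - - ⟨γ, rfl⟩ ⟨γ', rfl⟩
    refine ⟨γ * γ', ?_⟩
    ext ω
    simp [evalCM_apply]

/-- Stone–Weierstrass; the evaluations separate the points of the dual group and their span is an
algebra. -/
theorem span_evalCM_closure_eq_top :
    (Submodule.span ℂ (Set.range (evalCM (Γ := Γ)))).topologicalClosure = ⊤ := by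
  rw [← toSubmodule_trigPoly]
  refine congr_arg (Subalgebra.toSubmodule <| StarSubalgebra.toSubalgebra ·)
    (ContinuousMap.starSubalgebra_topologicalClosure_eq_top_of_separatesPoints (trigPoly Γ) ?_)
  intro ω ω' h
  obtain ⟨γ, hγ⟩ : ∃ γ, ω γ ≠ ω' γ := by
    by_contra! hc
    exact h (PontryaginDual.ext hc)
  exact ⟨_, ⟨evalCM γ, Algebra.subset_adjoin ⟨γ, rfl⟩, rfl⟩,
    fun h => hγ (Circle.coe_injective h)⟩

theorem exists_span_evalCM_integral_sub_lt [Countable Γ] [IsFiniteMeasure μ]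
    {h : PontryaginDual Γ → ℂ} (hh : Integrable h μ) {ε : ℝ} (hε : 0 < ε) :
    ∃ p ∈ Submodule.span ℂ (Set.range (evalCM (Γ := Γ))), ∫ ω, ‖h ω - p ω‖ ∂μ < ε := by
  obtain ⟨g, hg, hgi⟩ := hh.exists_boundedContinuous_integral_sub_le (half_pos hε)
  -- The uniform error `δ` contributes `δ μ(univ)` to the integral; the `+ 1` keeps this strictly
  -- below `ε / 2`.
  set δ : ℝ := ε / 2 / (μ.real Set.univ + 1) with hδ
  have hδ0 : 0 < δ := by positivity
  have hcl : g.toContinuousMap ∈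
      closure (Submodule.span ℂ (Set.range (evalCM (Γ := Γ))) : Set C(PontryaginDual Γ, ℂ)) := by
    rw [← Submodule.topologicalClosure_coe, span_evalCM_closure_eq_top]
    trivial
  obtain ⟨p, hp, hgp⟩ := Metric.mem_closure_iff.1 hcl δ hδ0
  refine ⟨p, hp, ?_⟩
  have hpi : Integrable p μ := p.continuous.integrable_of_hasCompactSupport
    (HasCompactSupport.of_compactSpace _)
  calc ∫ ω, ‖h ω - p ω‖ ∂μ ≤ ∫ ω, (‖h ω - g ω‖ + δ) ∂μ := by
        refine integral_mono (hh.sub hpi).norm ((hh.sub hgi).norm.add (integrable_const _))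
          fun ω => ?_
        have h1 : ‖g ω - p ω‖ ≤ δ := by
          rw [← dist_eq_norm]
          exact (ContinuousMap.dist_apply_le_dist (f := g.toContinuousMap) (g := p) ω).trans hgp.le
        calc ‖h ω - p ω‖ = ‖(h ω - g ω) + (g ω - p ω)‖ := by rw [sub_add_sub_cancel]
          _ ≤ ‖h ω - g ω‖ + δ := (norm_add_le _ _).trans (by gcongr)
    _ = ∫ ω, ‖h ω - g ω‖ ∂μ + δ * μ.real Set.univ := by
        rw [integral_add (f := fun ω => ‖h ω - g ω‖) (hh.sub hgi).norm (integrable_const _)]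
        simp [mul_comm]
    _ < ε / 2 + ε / 2 := by
        refine add_lt_add_of_le_of_lt hg ?_
        rw [hδ, div_mul_eq_mul_div, div_lt_iff₀ (by positivity)]
        nlinarith
    _ = ε := add_halves ε

end PontryaginDual

open PontryaginDual

/-- The continuous functions whose successive fiber means can be chosen to be continuous and to be
eventually equal to a constant. -/
def HasConstantMeans (μ : Measure (PontryaginDual Γ)) (α : Γ →* Γ) [Fintype (dualKer α)]
    (p : C(PontryaginDual Γ, ℂ)) : Prop :=
  ∃ q : ℕ → C(PontryaginDual Γ, ℂ), q 0 = p ∧ (∀ n, IsFiberMean μ α (q n) (q (n + 1))) ∧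
    ∃ (d : ℂ) (n₀ : ℕ), ∀ n ≥ n₀, ∀ ω, q n ω = d

namespace HasConstantMeans

variable [Fintype (dualKer α)] {p p' : C(PontryaginDual Γ, ℂ)}

theorem of_isFiberMean (h : IsFiberMean μ α p p') (hp' : HasConstantMeans μ α p') :
    HasConstantMeans μ α p := by
  obtain ⟨q, h0, hq, d, n₀, hd⟩ := hp'
  refine ⟨fun n => Nat.casesOn n p q, rfl, fun n => ?_, d, n₀ + 1, fun n hn ω => ?_⟩
  · subst h0
    cases n with
    | zero => exact h
    | succ n => exact hq n
  · obtain ⟨n, rfl⟩ : ∃ k, n = k + 1 := ⟨n - 1, by omega⟩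
    exact hd n (by omega) ω

theorem add (hp : HasConstantMeans μ α p) (hp' : HasConstantMeans μ α p') :
    HasConstantMeans μ α (p + p') := by
  obtain ⟨q, h0, hq, d, n₀, hd⟩ := hp
  obtain ⟨q', h0', hq', d', n₀', hd'⟩ := hp'
  refine ⟨fun n => q n + q' n, by simp only [h0, h0'], fun n => (hq n).add (hq' n), d + d', max n₀ n₀',
    fun n hn ω => ?_⟩
  rw [ContinuousMap.add_apply, hd n (by omega), hd' n (by omega)]

theorem smul (c : ℂ) (hp : HasConstantMeans μ α p) : HasConstantMeans μ α (c • p) := by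
  obtain ⟨q, h0, hq, d, n₀, hd⟩ := hp
  refine ⟨fun n => c • q n, by simp only [h0], fun n => (hq n).const_mul c, c * d, n₀, fun n hn ω => ?_⟩
  rw [ContinuousMap.smul_apply, hd n hn, smul_eq_mul]

theorem const (hα : IsDilation α) (c : ℂ) : HasConstantMeans μ α (ContinuousMap.const _ c) := by
  refine ⟨fun _ => ContinuousMap.const _ c, rfl, fun n => .of_forall fun ω => ?_, c, 0,
    fun n _ ω => rfl⟩
  simp [← card_dualKer hα]

/-- If `γ = α γ'`, evaluation at `γ` is constant on fibers with mean the evaluation at `γ'`; if `γ ∉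
α(Γ)`, the mean is `0` by orthogonality. When `γ ≠ 1` misses the range of `α^n`, the value `0` is
reached after at most `n` means. -/
theorem evalCM (hα : IsDilation α) (γ : Γ) :
    HasConstantMeans μ α (PontryaginDual.evalCM γ) := by
  by_cases h1 : γ = 1
  · subst h1
    convert const (μ := μ) hα 1 using 1
    ext ω
    simp [evalCM_apply]
  obtain ⟨n, hn⟩ : ∃ n : ℕ, γ ∉ Set.range (α^[n]) := by
    by_contra! hc
    exact h1 (by simpa [hα.iInter_range] using Set.mem_iInter.2 hc)
  clear h1
  induction n generalizing γ with
  | zero => exact absurd ⟨γ, rfl⟩ hn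
  | succ n ih =>
    by_cases hγ : γ ∈ α.range
    · obtain ⟨γ', rfl⟩ := hγ
      refine of_isFiberMean (.of_forall fun ω => ?_) (ih γ' fun ⟨δ, hδ⟩ => hn ⟨δ, ?_⟩)
      · have h2 : ∀ κ : dualKer α, PontryaginDual.evalCM (α γ') (ω * κ) =
            PontryaginDual.evalCM γ' (dualEnd α ω) := fun κ => by
          have h3 : dualEnd α (ω * κ) = dualEnd α ω := by rw [_root_.map_mul, κ.2, mul_one]
          rw [← h3]
          rfl
        simp [h2, ← card_dualKer hα]
      · rw [Function.iterate_succ_apply', hδ]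
    · refine of_isFiberMean (p' := ContinuousMap.const _ 0) (.of_forall fun ω => ?_) (const hα 0)
      have h2 : ∀ κ : dualKer α, PontryaginDual.evalCM γ (ω * κ) =
          PontryaginDual.evalCM γ ω * (((κ : PontryaginDual Γ) γ : Circle) : ℂ) := fun κ => by
        exact Circle.coe_mul _ _
      simp_rw [h2, ← Finset.mul_sum, sum_dualKer_apply_eq_zero hα hγ]
      simp

theorem of_mem_span (hα : IsDilation α)
    (hp : p ∈ Submodule.span ℂ (Set.range (PontryaginDual.evalCM (Γ := Γ)))) :
    HasConstantMeans μ α p := by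
  induction hp using Submodule.span_induction with
  | mem x hx => obtain ⟨γ, rfl⟩ := hx; exact evalCM hα γ
  | zero => exact const hα 0
  | add x y _ _ hx hy => exact hx.add hy
  | smul c x _ hx => exact hx.smul c

end HasConstantMeans

/-- The endomorphism `α*` is exact: successive fiber means of an integrable function converge to a
constant in mean. -/
theorem tendsto_integral_norm_sub_of_isFiberMean [Countable Γ] [Fintype (dualKer α)]
    (hα : IsDilation α) [μ.IsHaarMeasure] {h : ℕ → PontryaginDual Γ → ℂ}
    (hi : ∀ n, Integrable (h n) μ) (hh : ∀ n, IsFiberMean μ α (h n) (h (n + 1))) :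
    Filter.Tendsto (fun n => ∫ ω, ‖h n ω - (μ.real Set.univ : ℂ)⁻¹ * ∫ ζ, h 0 ζ ∂μ‖ ∂μ)
      Filter.atTop (nhds 0) := by
  have hM : (μ.real Set.univ : ℂ) ≠ 0 := by
    exact_mod_cast (measureReal_ne_zero_iff (measure_ne_top _ _)).2 (NeZero.ne (μ Set.univ))
  set c := (μ.real Set.univ : ℂ)⁻¹ * ∫ ζ, h 0 ζ ∂μ with hc
  have hint : ∀ n, ∫ ω, h n ω ∂μ = μ.real Set.univ * c := by
    intro n
    induction n with
    | zero => rw [hc, mul_inv_cancel_left₀ hM]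
    | succ n ih => rw [(hh n).integral_eq hα (hi n) (hi _), ih]
  refine Metric.tendsto_atTop.2 fun ε hε => ?_
  obtain ⟨p, hp, hlt⟩ := exists_span_evalCM_integral_sub_lt (hi 0) (half_pos hε)
  obtain ⟨q, h0, hq, d, n₀, hd⟩ := HasConstantMeans.of_mem_span (μ := μ) hα hp
  have hqi : ∀ n, Integrable (q n) μ := fun n =>
    (q n).continuous.integrable_of_hasCompactSupport (HasCompactSupport.of_compactSpace _)
  -- Contractivity keeps `h n` as close to `q n` as `h 0` is to the trigonometric polynomial `p`.
  have hle : ∀ n, ∫ ω, ‖h n ω - q n ω‖ ∂μ < ε / 2 := by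
    intro n
    induction n with
    | zero => rwa [h0]
    | succ n ih =>
      exact (((hh n).sub (hq n)).integral_norm_le hα ((hi n).sub (hqi n))
        ((hi _).sub (hqi _))).trans_lt ih
  refine ⟨n₀, fun n hn => ?_⟩
  have hn' := hle n
  simp_rw [hd n hn] at hn'
  -- The eventual constant `d` depends on `p`; it is close to `c` because fiber means preserve the
  -- integral.
  have hcd : μ.real Set.univ * ‖c - d‖ < ε / 2 := by
    calc μ.real Set.univ * ‖c - d‖ = ‖∫ ω, (h n ω - d) ∂μ‖ := by
          rw [integral_sub (hi n) (integrable_const _), hint, integral_const, Complex.real_smul,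
            ← mul_sub, norm_mul, Complex.norm_real, Real.norm_of_nonneg measureReal_nonneg]
      _ ≤ ∫ ω, ‖h n ω - d‖ ∂μ := norm_integral_le_integral_norm _
      _ < ε / 2 := hn'
  rw [Real.dist_eq, sub_zero, abs_of_nonneg (integral_nonneg fun _ => norm_nonneg _)]
  calc ∫ ω, ‖h n ω - c‖ ∂μ ≤ ∫ ω, (‖h n ω - d‖ + ‖c - d‖) ∂μ := by
        refine integral_mono ((hi n).sub (integrable_const _)).norm
          (((hi n).sub (integrable_const _)).norm.add (integrable_const _)) fun ω => ?_
        rw [← norm_sub_rev d c]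
        calc ‖h n ω - c‖ = ‖(h n ω - d) + (d - c)‖ := by rw [sub_add_sub_cancel]
          _ ≤ _ := norm_add_le _ _
    _ = ∫ ω, ‖h n ω - d‖ ∂μ + μ.real Set.univ * ‖c - d‖ := by
        rw [integral_add (f := fun ω => ‖h n ω - d‖) ((hi n).sub (integrable_const _)).norm
          (integrable_const _)]
        simp
    _ < ε / 2 + ε / 2 := add_lt_add hn' hcd
    _ = ε := add_halves ε

end Exactness

/-! ### Pointwise inner products and their behaviour under the Ruelle operator -/

section FiberInner

set_option linter.unusedSectionVars false

variable {Γ : Type*} [CommGroup Γ] [TopologicalSpace Γ] [DiscreteTopology Γ] {α : Γ →* Γ}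
  {μ : Measure (PontryaginDual Γ)} {m : PontryaginDual Γ → ℕ}
  {H : PontryaginDual Γ → Matrix ℕ ℕ ℂ}

/-- The inner product of the first `m ω` coordinates at `ω`. -/
def fiberInner (m : PontryaginDual Γ → ℕ) (f g : ℕ → PontryaginDual Γ → ℂ)
    (ω : PontryaginDual Γ) : ℂ :=
  ∑ i ∈ Finset.range (m ω), f i ω * conj (g i ω)

theorem measurable_sum_range (hm : Measurable m) {f : ℕ → PontryaginDual Γ → ℂ}
    (hf : ∀ i, Measurable (f i)) : Measurable fun ω => ∑ i ∈ Finset.range (m ω), f i ω := by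
  have hF : Measurable fun p : ℕ × PontryaginDual Γ => ∑ i ∈ Finset.range p.1, f i p.2 :=
    measurable_from_prod_countable_right fun n =>
      Finset.measurable_fun_sum (Finset.range n) fun i _ => hf i
  exact hF.comp (hm.prodMk measurable_id)

theorem measurable_fiberInner (hm : Measurable m) {f g : ℕ → PontryaginDual Γ → ℂ}
    (hf : ∀ i, Measurable (f i)) (hg : ∀ i, Measurable (g i)) : Measurable (fiberInner m f g) :=
  measurable_sum_range hm fun i => (hf i).mul (Complex.continuous_conj.measurable.comp (hg i))

theorem fiberInner_eq_tsum (f g : ℕ → PontryaginDual Γ → ℂ) (ω : PontryaginDual Γ) :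
    fiberInner m f g ω =
      ∑' i, (sigmaSet m i).indicator (fun ω => f i ω * conj (g i ω)) ω := by
  rw [tsum_eq_sum (s := Finset.range (m ω))]
  · refine Finset.sum_congr rfl fun i hi => ?_
    rw [Set.indicator_of_mem (show ω ∈ sigmaSet m i by simpa [sigmaSet] using hi)]
  · intro i hi
    exact Set.indicator_of_notMem (by simpa [sigmaSet] using hi) _

theorem CoreSpace.measurable (f : CoreSpace μ m) (i : ℕ) : Measurable (f i) :=
  (Lp.stronglyMeasurable (f i)).measurable

theorem CoreSpace.measurable_indicator_mul_conj (hm : Measurable m) (f g : CoreSpace μ m) (i : ℕ) :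
    Measurable fun ω => (sigmaSet m i).indicator (fun ω => f i ω * conj (g i ω)) ω :=
  Measurable.indicator ((CoreSpace.measurable f i).mul
    (Complex.continuous_conj.measurable.comp (CoreSpace.measurable g i)))
    (measurableSet_sigmaSet hm i)

/-- From `x y ≤ x² + y²`. This justifies exchanging the sum over coordinates with the integral. -/
theorem tsum_lintegral_indicator_mul_conj_ne_top (hm : Measurable m) (f g : CoreSpace μ m) :
    ∑' i, ∫⁻ ω, ‖(sigmaSet m i).indicator (fun ω => f i ω * conj (g i ω)) ω‖ₑ ∂μ ≠ ∞ := by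
  have hle : ∀ i, ∫⁻ ω, ‖(sigmaSet m i).indicator (fun ω => f i ω * conj (g i ω)) ω‖ₑ ∂μ ≤
      ‖f i‖ₑ ^ 2 + ‖g i‖ₑ ^ 2 := by
    intro i
    simp_rw [enorm_indicator_eq_indicator_enorm]
    rw [lintegral_indicator (measurableSet_sigmaSet hm i), Lp_enorm_sq, Lp_enorm_sq,
      ← lintegral_add_left ((CoreSpace.measurable f i).enorm.pow_const 2)]
    refine lintegral_mono fun ω => ?_
    rw [enorm_mul, RCLike.enorm_conj]
    rcases le_total ‖f i ω‖ₑ ‖g i ω‖ₑ with h | h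
    · calc ‖f i ω‖ₑ * ‖g i ω‖ₑ ≤ ‖g i ω‖ₑ * ‖g i ω‖ₑ := by gcongr
        _ ≤ _ := by rw [sq ‖g i ω‖ₑ]; exact le_add_self
    · calc ‖f i ω‖ₑ * ‖g i ω‖ₑ ≤ ‖f i ω‖ₑ * ‖f i ω‖ₑ := by gcongr
        _ ≤ _ := by rw [sq ‖f i ω‖ₑ]; exact le_self_add
  refine ne_top_of_le_ne_top ?_ (ENNReal.tsum_le_tsum hle)
  rw [ENNReal.tsum_add]
  exact ENNReal.add_ne_top.2 ⟨(memℓp_two_iff _).1 (lp.memℓp f), (memℓp_two_iff _).1 (lp.memℓp g)⟩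

theorem integrable_fiberInner (hm : Measurable m) (f g : CoreSpace μ m) :
    Integrable (fiberInner m (fun i => f i) (fun i => g i)) μ := by
  refine ⟨(measurable_fiberInner hm (CoreSpace.measurable f)
    (CoreSpace.measurable g)).aestronglyMeasurable, ?_⟩
  have h1 := tsum_lintegral_indicator_mul_conj_ne_top hm f g
  rw [← lintegral_tsum fun i =>
    (CoreSpace.measurable_indicator_mul_conj hm f g i).enorm.aemeasurable] at h1
  refine lt_of_le_of_lt (lintegral_mono fun ω => ?_) h1.lt_top
  refine (enorm_sum_le _ _).trans ((Finset.sum_congr rfl fun i hi => ?_).trans_le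
    (ENNReal.sum_le_tsum (Finset.range (m ω))))
  rw [Set.indicator_of_mem (show ω ∈ sigmaSet m i by simpa [sigmaSet] using hi)]

/-- The arguments are swapped because `inner` is conjugate linear in its first argument. -/
theorem integral_fiberInner (hm : Measurable m) (f g : CoreSpace μ m) :
    ∫ ω, fiberInner m (fun i => f i) (fun i => g i) ω ∂μ = inner ℂ g f := by
  simp_rw [fiberInner_eq_tsum]
  rw [integral_tsum (fun i =>
    (CoreSpace.measurable_indicator_mul_conj hm f g i).aestronglyMeasurable)
    (tsum_lintegral_indicator_mul_conj_ne_top hm f g), lp.inner_eq_tsum]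
  refine tsum_congr fun i => ?_
  rw [integral_indicator (measurableSet_sigmaSet hm i), L2.inner_def]
  rfl

/-- Polarized form of `sum_norm_sq_matrix`: with the blocks `h κ` side by side, the first `M` rows
are orthogonal of squared length `N`, so the transpose scales inner products by `N`. -/
theorem sum_mul_conj_matrix {K : Type*} [Fintype K] (M : ℕ) (d : K → ℕ) (N : ℂ)
    (h : K → ℕ → ℕ → ℂ) (hd : ∀ κ i j, d κ ≤ j → h κ i j = 0)
    (hh : ∀ i < M, ∀ i' < M, ∑ κ, ∑' j, h κ i j * conj (h κ i' j) = if i = i' then N else 0)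
    (v w : ℕ → ℂ) :
    ∑ κ, ∑ j ∈ Finset.range (d κ), (∑ i ∈ Finset.range M, h κ i j * v i) *
        conj (∑ i ∈ Finset.range M, h κ i j * w i) =
      N * ∑ i ∈ Finset.range M, v i * conj (w i) := by
  have hh' : ∀ i < M, ∀ i' < M, ∑ κ, ∑ j ∈ Finset.range (d κ), h κ i j * conj (h κ i' j)
      = if i = i' then N else 0 := by
    intro i hi i' hi'
    rw [← hh i hi i' hi']
    refine Finset.sum_congr rfl fun κ _ => ?_
    rw [tsum_eq_sum]
    intro j hj
    rw [hd κ i j (by simpa using hj), zero_mul]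
  have key : ∀ κ j, (∑ i ∈ Finset.range M, h κ i j * v i) *
      conj (∑ i ∈ Finset.range M, h κ i j * w i) =
      ∑ i ∈ Finset.range M, ∑ i' ∈ Finset.range M,
        (v i * conj (w i')) * (h κ i j * conj (h κ i' j)) := by
    intro κ j
    rw [map_sum, Finset.sum_mul_sum]
    refine Finset.sum_congr rfl fun i _ => Finset.sum_congr rfl fun i' _ => ?_
    rw [map_mul]; ring
  simp_rw [key]
  calc _ = ∑ i ∈ Finset.range M, ∑ i' ∈ Finset.range M, (v i * conj (w i')) *
        ∑ κ, ∑ j ∈ Finset.range (d κ), h κ i j * conj (h κ i' j) := by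
        simp_rw [Finset.mul_sum]
        rw [Finset.sum_congr rfl fun κ _ => Finset.sum_comm, Finset.sum_comm]
        refine Finset.sum_congr rfl fun i _ => ?_
        rw [Finset.sum_congr rfl fun κ _ => Finset.sum_comm, Finset.sum_comm]
    _ = ∑ i ∈ Finset.range M, (v i * conj (w i)) * N := by
        refine Finset.sum_congr rfl fun i hi => ?_
        rw [Finset.sum_eq_single_of_mem i hi]
        · rw [hh' i (by simpa using hi) i (by simpa using hi), if_pos rfl]
        · intro i' hi' hne
          rw [hh' i (by simpa using hi) i' (by simpa using hi'), if_neg hne.symm, mul_zero]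
    _ = _ := by rw [← Finset.sum_mul, mul_comm]

theorem IsFilter.ae_dualEnd (hα : IsDilation α) [μ.IsHaarMeasure] [Fintype (dualKer α)]
    (hH : IsFilter μ α m H) : ∀ᵐ ω ∂μ,
      (∀ (κ : dualKer α) i j, m (ω * κ) ≤ j → H (ω * κ) i j = 0) ∧
      ∀ i i', ∑ κ : dualKer α, ∑' j, H (ω * κ) i j * conj (H (ω * κ) i' j) =
        if i = i' ∧ i < m (dualEnd α ω) then (α.range.index : ℂ) else 0 := by
  have h1 := ae_mul_dualKer hα (ae_all_iff.2 fun i => ae_all_iff.2 fun j => hH.support i j)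
  have h2 := (dualEnd_measurePreserving hα μ).quasiMeasurePreserving.ae
    (ae_all_iff.2 fun i => ae_all_iff.2 fun i' => hH.filter_eq i i')
  filter_upwards [h1, h2] with ω h1 h2
  refine ⟨fun κ i j hj => h1 κ i j (by simpa [sigmaSet] using hj), fun i i' => ?_⟩
  rw [← fiberSum_dualEnd α (fun ζ => ∑' j, H ζ i j * conj (H ζ i' j)), h2 i i']
  by_cases hi : i = i' <;> by_cases hi' : i < m (dualEnd α ω) <;>
    simp [hi, hi', sigmaSet, Set.indicator]

/-- The filter equation enters here: over one fiber, the blocks `H(ω κ)` all act on the same vectors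
`f(α* ω)` and `g(α* ω)` and together scale their inner product by `N`. -/
theorem isFiberMean_fiberInner_ruelle (hα : IsDilation α) [μ.IsHaarMeasure]
    [Fintype (dualKer α)] (hm : Measurable m) (hH : IsFilter μ α m H) (f g : CoreSpace μ m) :
    IsFiberMean μ α
      (fiberInner m (fun i => ruelle hα hm hH f i) (fun i => ruelle hα hm hH g i))
      (fiberInner m (fun i => f i) (fun i => g i)) := by
  have hS : ∀ f : CoreSpace μ m, ∀ᵐ ω ∂μ, ∀ κ : dualKer α, ∀ j,
      ω * (κ : PontryaginDual Γ) ∈ sigmaSet m j →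
      ruelle hα hm hH f j (ω * κ) = ruelleFun α m H (fun i => f i) j (ω * κ) := fun f =>
    ae_mul_dualKer hα (ae_all_iff.2 fun j =>
      (ae_restrict_iff' (measurableSet_sigmaSet hm j)).1 (ruelle_apply_ae hα hm hH f j))
  filter_upwards [hS f, hS g, hH.ae_dualEnd hα] with ω hf hg ⟨h1, h2⟩
  have hk : ∀ κ : dualKer α, dualEnd α (ω * (κ : PontryaginDual Γ)) = dualEnd α ω := fun κ => by
    rw [map_mul, κ.2, mul_one]
  rw [fiberInner, ← sum_mul_conj_matrix (m (dualEnd α ω)) (fun κ : dualKer α =>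
    m (ω * (κ : PontryaginDual Γ)))
    α.range.index (fun κ i j => H (ω * κ) i j) h1 (fun i hi i' _ => by simp [h2, hi])
    (fun i => f i (dualEnd α ω)) (fun i => g i (dualEnd α ω))]
  refine Finset.sum_congr rfl fun κ _ => Finset.sum_congr rfl fun j hj => ?_
  have hj' : ω * (κ : PontryaginDual Γ) ∈ sigmaSet m j := by simpa [sigmaSet] using hj
  simp only [hf κ j hj', hg κ j hj', ruelleFun, hk]

end FiberInner

/-! ### The intersection of the ranges of an isometry, and a rank bound -/

namespace LinearIsometry

variable {E : Type*} [NormedAddCommGroup E] [NormedSpace ℂ E] (S : E →ₗᵢ[ℂ] E)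

/-- The intersection of the ranges of the powers of an isometry. -/
noncomputable def iInfRange : Submodule ℂ E := ⨅ n : ℕ, LinearMap.range (S.toLinearMap ^ n)

variable {S}

theorem mem_iInfRange {x : E} : x ∈ S.iInfRange ↔ ∀ n : ℕ, ∃ y, S^[n] y = x := by
  simp [iInfRange, Submodule.mem_iInf, LinearMap.mem_range, Module.End.pow_apply]

theorem isPureIsometry_iff : IsPureIsometry S ↔ S.iInfRange = ⊥ := by
  rw [← SetLike.coe_set_eq, Submodule.bot_coe, IsPureIsometry]
  have : (S.iInfRange : Set E) = ⋂ n : ℕ, Set.range (S^[n]) := by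
    ext x
    simp [mem_iInfRange]
  rw [this]

theorem map_mem_iInfRange {x : E} (hx : x ∈ S.iInfRange) : S x ∈ S.iInfRange :=
  mem_iInfRange.2 fun n => by
    obtain ⟨y, hy⟩ := mem_iInfRange.1 hx n
    exact ⟨S y, by rw [← Function.iterate_succ_apply, Function.iterate_succ_apply', hy]⟩

theorem mem_iInfRange_of_apply_eq_smul {x : E} {c : ℂ} (hc : c ≠ 0) (hx : S x = c • x) :
    x ∈ S.iInfRange :=
  mem_iInfRange.2 fun n => by
    induction n with
    | zero => exact ⟨x, rfl⟩
    | succ n ih =>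
      obtain ⟨y, hy⟩ := ih
      refine ⟨c⁻¹ • y, ?_⟩
      rw [Function.iterate_succ_apply', ← S.coe_toLinearMap, ← Module.End.pow_apply, map_smul,
        Module.End.pow_apply, S.coe_toLinearMap, hy, S.map_smul, hx, inv_smul_smul₀ hc]

/-- The intersection is invariant and nonzero, so over `ℂ` the restriction has an eigenvalue; norm
preservation puts it on the unit circle. -/
theorem exists_eigenvector_of_finite (hS : ¬ IsPureIsometry S) [FiniteDimensional ℂ S.iInfRange] :
    ∃ (x : E) (c : ℂ), x ≠ 0 ∧ ‖c‖ = 1 ∧ S x = c • x := by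
  have : Nontrivial S.iInfRange := by
    rw [Submodule.nontrivial_iff_ne_bot]
    exact fun h => hS (isPureIsometry_iff.2 h)
  obtain ⟨c, hc⟩ := Module.End.exists_eigenvalue
    (S.toLinearMap.restrict (p := S.iInfRange) (q := S.iInfRange) fun x hx => map_mem_iInfRange hx)
  obtain ⟨x, hx⟩ := hc.exists_hasEigenvector
  have hx0 : (x : E) ≠ 0 := fun h => hx.2 (Subtype.ext h)
  have hSx : S x = c • (x : E) := congrArg Subtype.val hx.apply_eq_smul
  refine ⟨x, c, hx0, ?_, hSx⟩
  have h1 := S.norm_map (x : E)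
  rw [hSx, norm_smul] at h1
  exact mul_right_cancel₀ (norm_ne_zero_iff.2 hx0) (h1.trans (one_mul _).symm)

end LinearIsometry

/-- The matrix factors through `ℂ^M`, so its rank is at most `M`. -/
theorem Matrix.det_eq_zero_of_eq_sum_range {ι : Type*} [Fintype ι] [DecidableEq ι] (M : ℕ)
    (hM : M < Fintype.card ι) (u v : ι → ℕ → ℂ) :
    (Matrix.of fun i j => ∑ k ∈ Finset.range M, u i k * v j k).det = 0 := by
  by_contra h
  have e : (Matrix.of fun i j => ∑ k ∈ Finset.range M, u i k * v j k) =
      (Matrix.of fun i (k : Fin M) => u i k) * (Matrix.of fun (k : Fin M) j => v j k) := by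
    ext i j
    simp [Matrix.mul_apply, Finset.sum_range]
  have h1 := Matrix.rank_of_isUnit _ ((Matrix.isUnit_iff_isUnit_det _).2 (isUnit_iff_ne_zero.2 h))
  rw [e] at h1
  have h2 := (Matrix.rank_mul_le_left (Matrix.of fun i (k : Fin M) => u i k)
    (Matrix.of fun (k : Fin M) j => v j k)).trans (Matrix.rank_le_card_width _)
  rw [h1, Fintype.card_fin] at h2
  omega

/-! ### Finite dimensionality of the intersection, and an eigenvector of constant pointwise norm -/

section Eigenvector

set_option linter.unusedSectionVars false

variable {Γ : Type*} [CommGroup Γ] [TopologicalSpace Γ] [DiscreteTopology Γ] [Countable Γ]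
  {α : Γ →* Γ} {μ : Measure (PontryaginDual Γ)} {m : PontryaginDual Γ → ℕ}
  {H : PontryaginDual Γ → Matrix ℕ ℕ ℂ}

/-- Along backward orbits of `S_H` the pointwise inner products are successive fiber means, so
exactness applies; the limit is the average of the first one. -/
theorem tendsto_integral_norm_fiberInner_sub (hα : IsDilation α) [μ.IsHaarMeasure]
    (hm : Measurable m) (hH : IsFilter μ α m H) {f g : ℕ → CoreSpace μ m}
    (hf : ∀ n, ruelle hα hm hH (f (n + 1)) = f n) (hg : ∀ n, ruelle hα hm hH (g (n + 1)) = g n) :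
    Filter.Tendsto (fun n => ∫ ω, ‖fiberInner m (fun i => f n i) (fun i => g n i) ω -
      (μ.real Set.univ : ℂ)⁻¹ * inner ℂ (g 0) (f 0)‖ ∂μ) Filter.atTop (nhds 0) := by
  have := hα.finite_dualKer
  have := Fintype.ofFinite (dualKer α)
  rw [← integral_fiberInner hm]
  refine tendsto_integral_norm_sub_of_isFiberMean hα (fun n => integrable_fiberInner hm _ _)
    fun n => ?_
  have h := isFiberMean_fiberInner_ruelle hα hm hH (f (n + 1)) (g (n + 1))
  rwa [hf, hg] at h

/-- One subsequence serves all `i` because the finite sum of the norms tends to zero in `L¹`. -/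
theorem exists_seq_ae_tendsto_zero {X ι : Type*} [MeasurableSpace X] {ν : Measure X} [Fintype ι]
    {φ : ι → ℕ → X → ℂ} (hφ : ∀ i n, Integrable (φ i n) ν)
    (h : ∀ i, Filter.Tendsto (fun n => ∫ x, ‖φ i n x‖ ∂ν) Filter.atTop (nhds 0)) :
    ∃ ns : ℕ → ℕ, ∀ᵐ x ∂ν, ∀ i, Filter.Tendsto (fun k => φ i (ns k) x) Filter.atTop (nhds 0) := by
  have hi : ∀ n, Integrable (fun x => ∑ i, ‖φ i n x‖) ν := fun n =>
    integrable_finsetSum _ fun i _ => (hφ i n).norm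
  have h1 : Filter.Tendsto (fun n => eLpNorm ((fun x => ∑ i, ‖φ i n x‖) - 0) 1 ν)
      Filter.atTop (nhds 0) := by
    have h2 := tendsto_finsetSum Finset.univ fun i _ => h i
    rw [Finset.sum_const_zero] at h2
    have h3 := ENNReal.tendsto_ofReal h2
    rw [ENNReal.ofReal_zero] at h3
    refine h3.congr fun n => ?_
    rw [sub_zero, eLpNorm_one_eq_lintegral_enorm, ← integral_finsetSum _ fun i _ => (hφ i n).norm,
      ofReal_integral_eq_lintegral_ofReal (hi n)
        (.of_forall fun x => Finset.sum_nonneg fun i _ => norm_nonneg _)]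
    refine lintegral_congr fun x => ?_
    rw [Real.enorm_of_nonneg (Finset.sum_nonneg fun i _ => norm_nonneg _)]
  obtain ⟨ns, -, hns⟩ := (tendstoInMeasure_of_tendsto_eLpNorm one_ne_zero
    (fun n => (hi n).aestronglyMeasurable) aestronglyMeasurable_zero h1).exists_seq_tendsto_ae
  refine ⟨ns, hns.mono fun x hx i => squeeze_zero_norm (fun k => ?_) hx⟩
  exact Finset.single_le_sum (f := fun i => ‖φ i (ns k) x‖) (fun i _ => norm_nonneg _)
    (Finset.mem_univ i)

theorem exists_measure_preimage_singleton_ne_zero [μ.IsHaarMeasure] (m : PontryaginDual Γ → ℕ) :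
    ∃ M, μ (m ⁻¹' {M}) ≠ 0 := by
  by_contra! h
  refine NeZero.ne (μ Set.univ) ?_
  rw [← Set.preimage_univ (f := m), ← Set.iUnion_of_singleton ℕ, Set.preimage_iUnion]
  exact measure_iUnion_null h

open scoped ComplexOrder in
/-- The ranges of the powers of the Ruelle operator intersect in a finite dimensional space. -/
theorem finiteDimensional_iInfRange_ruelle (hα : IsDilation α) [μ.IsHaarMeasure]
    (hm : Measurable m) (hH : IsFilter μ α m H) :
    FiniteDimensional ℂ (ruelle hα hm hH).iInfRange := by
  classical
  set S := ruelle hα hm hH with hS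
  -- A single level set of `m` of positive measure bounds the dimension.
  obtain ⟨M, hM⟩ := exists_measure_preimage_singleton_ne_zero (μ := μ) m
  have key : Module.rank ℂ S.iInfRange ≤ M := by
    refine rank_le fun s hs => ?_
    by_contra! hlt
    let v : s → CoreSpace μ m := fun i => ((i : S.iInfRange) : CoreSpace μ m)
    have hv : LinearIndependent ℂ v :=
      hs.map' S.iInfRange.subtype (Submodule.ker_subtype _)
    choose y hy using fun (n : ℕ) (i : s) => LinearIsometry.mem_iInfRange.1 (i : S.iInfRange).2 n
    have hy0 : ∀ i, y 0 i = v i := fun i => hy 0 i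
    have hys : ∀ n i, S (y (n + 1) i) = y n i := fun n i => by
      refine S.injective.iterate n ?_
      rw [hy n i, ← Function.iterate_succ_apply, hy]
    let G : ℕ → s → s → PontryaginDual Γ → ℂ := fun n i j =>
      fiberInner m (fun k => y n i k) (fun k => y n j k)
    let c : s → s → ℂ := fun i j => (μ.real Set.univ : ℂ)⁻¹ * inner ℂ (v j) (v i)
    obtain ⟨ns, hns⟩ := exists_seq_ae_tendsto_zero (ν := μ)
      (φ := fun (p : s × s) n ω => G n p.1 p.2 ω - c p.1 p.2)
      (fun p n => (integrable_fiberInner hm _ _).sub (integrable_const _))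
      (fun p => by
        have h := tendsto_integral_norm_fiberInner_sub hα hm hH (f := fun n => y n p.1)
          (g := fun n => y n p.2) (fun n => hys n _) (fun n => hys n _)
        simp only [hy0] at h
        exact h)
    -- The exceptional null set cannot cover the level set, so convergence holds at some point with
    -- `m ω = M`.
    obtain ⟨ω, hωM, hω⟩ : ∃ ω, m ω = M ∧ ∀ p : s × s, Filter.Tendsto
        (fun k => G (ns k) p.1 p.2 ω - c p.1 p.2) Filter.atTop (nhds 0) := by
      by_contra! hc
      refine hM (measure_mono_null (fun ω hω => ?_) hns)
      obtain ⟨p, hp⟩ := hc ω hω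
      exact fun h => hp (h p)
    have hlim : Filter.Tendsto (fun k => (Matrix.of fun i j => G (ns k) i j ω)) Filter.atTop
        (nhds (Matrix.of c)) :=
      tendsto_pi_nhds.2 fun i => tendsto_pi_nhds.2 fun j => by
        simpa using (hω (i, j)).add_const (c i j)
    have hdet := ((Continuous.matrix_det continuous_id).tendsto (Matrix.of c)).comp hlim
    -- More than `M` vectors in an `M`-dimensional fiber have a singular Gram matrix, and so does
    -- the limit.
    have h0 : ∀ k, (Matrix.of fun i j => G (ns k) i j ω).det = 0 := fun k => by
      simp only [G, fiberInner, hωM]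
      exact Matrix.det_eq_zero_of_eq_sum_range M (by simpa using hlt) _ _
    have hdet0 : (Matrix.of c).det = 0 := by
      refine tendsto_nhds_unique hdet (tendsto_const_nhds.congr fun k => ?_)
      exact (h0 k).symm
    have hc : Matrix.of c = (μ.real Set.univ : ℂ)⁻¹ • (Matrix.gram ℂ v).transpose := by
      ext i j
      simp [c, Matrix.gram]
    rw [hc, Matrix.det_smul, Matrix.det_transpose] at hdet0
    refine mul_ne_zero (pow_ne_zero _ (inv_ne_zero ?_))
      ((Matrix.isUnit_iff_isUnit_det _).1
        (Matrix.posDef_gram_of_linearIndependent hv).isUnit).ne_zero hdet0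
    exact_mod_cast measureReal_univ_pos.ne'
  exact Module.rank_lt_aleph0_iff.1 (key.trans_lt (Cardinal.natCast_lt_aleph0))

/-- An eigenvector of the Ruelle operator can be scaled to have norm one in almost every fiber. -/
theorem exists_fiberwise_unit_eigenvector (hα : IsDilation α) [μ.IsHaarMeasure]
    (hm : Measurable m) (hH : IsFilter μ α m H) (hS : ¬ IsPureIsometry (ruelle hα hm hH)) :
    ∃ (f : CoreSpace μ m) (c : ℂ), ‖c‖ = 1 ∧ ruelle hα hm hH f = c • f ∧
      ∀ᵐ ω ∂μ, fiberInner m (fun i => f i) (fun i => f i) ω = 1 := by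
  have := finiteDimensional_iInfRange_ruelle hα hm hH
  obtain ⟨f₀, c, hf₀, hc, hSf₀⟩ := LinearIsometry.exists_eigenvector_of_finite hS
  have hc0 : c ≠ 0 := norm_ne_zero_iff.1 (by rw [hc]; exact one_ne_zero)
  have hμ := measureReal_univ_pos (μ := μ)
  -- Chosen so that `‖f‖² = μ(univ)`, which makes the average of the pointwise square norm equal to
  -- `1`.
  set r : ℝ := Real.sqrt (μ.real Set.univ) / ‖f₀‖ with hr
  set f : CoreSpace μ m := (r : ℂ) • f₀ with hf
  have hSf : ruelle hα hm hH f = c • f := by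
    rw [hf, LinearIsometry.map_smul, hSf₀, smul_comm]
  have hnf : ‖f‖ = Real.sqrt (μ.real Set.univ) := by
    rw [hf, norm_smul, Complex.norm_real, hr, Real.norm_of_nonneg (by positivity),
      div_mul_cancel₀ _ (norm_ne_zero_iff.2 hf₀)]
  refine ⟨f, c, hc, hSf, ?_⟩
  have hsmul : ∀ n : ℕ, fiberInner m (fun i => (c⁻¹ ^ n • f) i) (fun i => (c⁻¹ ^ n • f) i) =ᵐ[μ]
      fiberInner m (fun i => f i) (fun i => f i) := fun n => by
    have h1 : ∀ᵐ ω ∂μ, ∀ i, ω ∈ sigmaSet m i → (c⁻¹ ^ n • f) i ω = c⁻¹ ^ n * f i ω :=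
      ae_all_iff.2 fun i => (ae_restrict_iff' (measurableSet_sigmaSet hm i)).1
        (Lp.coeFn_smul (c⁻¹ ^ n) (f i))
    filter_upwards [h1] with ω h1
    refine Finset.sum_congr rfl fun i hi => ?_
    have hcn : c⁻¹ ^ n * conj (c⁻¹ ^ n) = 1 := by
      rw [Complex.mul_conj', norm_pow, norm_inv, hc]
      simp
    simp only [h1 i (by simpa [sigmaSet] using hi), map_mul]
    rw [mul_mul_mul_comm, hcn, one_mul]
  -- The vectors `c⁻¹ ^ n • f` form a backward orbit. By `hsmul` their pointwise norms do not depend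
  -- on `n`, so the norm of `f` already equals the limit.
  have h := tendsto_integral_norm_fiberInner_sub hα hm hH (f := fun n => c⁻¹ ^ n • f)
    (g := fun n => c⁻¹ ^ n • f) (fun n => by
      rw [LinearIsometry.map_smul, hSf, smul_smul, pow_succ, inv_mul_cancel_right₀ hc0])
    (fun n => by
      rw [LinearIsometry.map_smul, hSf, smul_smul, pow_succ, inv_mul_cancel_right₀ hc0])
  have e : (μ.real Set.univ : ℂ)⁻¹ * inner ℂ (c⁻¹ ^ 0 • f) (c⁻¹ ^ 0 • f) = 1 := by
    rw [pow_zero, one_smul, inner_self_eq_norm_sq_to_K, hnf]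
    have e1 : ((Real.sqrt (μ.real Set.univ) : ℝ) : ℂ) ^ 2 = (μ.real Set.univ : ℂ) := by
      rw [← Complex.ofReal_pow, Real.sq_sqrt hμ.le]
    exact (congrArg _ e1).trans (inv_mul_cancel₀ (by exact_mod_cast hμ.ne'))
  simp_rw [e] at h
  have hconst : ∀ n : ℕ, ∫ ω, ‖fiberInner m (fun i => (c⁻¹ ^ n • f) i)
      (fun i => (c⁻¹ ^ n • f) i) ω - 1‖ ∂μ =
      ∫ ω, ‖fiberInner m (fun i => f i) (fun i => f i) ω - 1‖ ∂μ := fun n =>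
    integral_congr_ae ((hsmul n).mono fun ω hω => by simp only [hω])
  have h0 := tendsto_nhds_unique (h.congr hconst) tendsto_const_nhds
  have h2 := (integral_eq_zero_iff_of_nonneg (fun ω => norm_nonneg _)
    ((integrable_fiberInner hm f f).sub (integrable_const 1)).norm).1 h0.symm
  filter_upwards [h2] with ω hω
  exact sub_eq_zero.1 (norm_eq_zero.1 hω)

end Eigenvector

/-! ### Completing a unit vector to a unitary matrix by an explicit formula -/

section Householder

/-- The phase of a complex number, with value `1` at `0`. -/
noncomputable def complexPhase (z : ℂ) : ℂ := if z = 0 then 1 else z / ‖z‖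

theorem measurable_complexPhase : Measurable complexPhase :=
  Measurable.ite (measurableSet_singleton 0) measurable_const
    (measurable_id.div (Complex.measurable_ofReal.comp measurable_norm))

theorem complexPhase_mul_conj (z : ℂ) : complexPhase z * conj (complexPhase z) = 1 := by
  rw [Complex.mul_conj', complexPhase]
  split_ifs with h
  · simp
  · rw [norm_div, Complex.norm_real, norm_norm, div_self (norm_ne_zero_iff.2 h)]
    simp

theorem norm_mul_complexPhase (z : ℂ) : ‖z‖ * complexPhase z = z := by
  rw [complexPhase]
  split_ifs with h
  · simp [h]
  · rw [mul_div_cancel₀]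
    exact_mod_cast norm_ne_zero_iff.2 h

/-- A `d × d` matrix, unitary and with first row `u` as soon as `u` is a unit vector of
length `d > 0`. It is a Householder reflection up to a phase. -/
noncomputable def householderRow (d : ℕ) (u : ℕ → ℂ) : Matrix ℕ ℕ ℂ := fun i j =>
  if i < d ∧ j < d then
    -complexPhase (u 0) * ((if i = j then 1 else 0) -
      (u j + if j = 0 then complexPhase (u 0) else 0) *
        conj (u i + if i = 0 then complexPhase (u 0) else 0) / (1 + ‖u 0‖))
  else 0

variable {d : ℕ} {u : ℕ → ℂ}

/-- With `s` the phase of `u 0`, everything follows from `s * conj (u 0 + s) = 1 + ‖u 0‖`; no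
normalization of `u` enters. Adding the phase keeps the denominator at least `1`. -/
theorem householderRow_zero {j : ℕ} (hj : j < d) : householderRow d u 0 j = u j := by
  have h0 : (1 + ‖u 0‖ : ℂ) ≠ 0 := by
    have : (0 : ℝ) < 1 + ‖u 0‖ := by positivity
    exact_mod_cast this.ne'
  rw [householderRow, if_pos ⟨by omega, hj⟩]
  set s := complexPhase (u 0) with hs
  have h1 : s * conj s = 1 := complexPhase_mul_conj _
  have h2 : ‖u 0‖ * s = u 0 := norm_mul_complexPhase _
  have h3 : s * conj (u 0 + s) = 1 + ‖u 0‖ := by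
    nth_rw 1 [← h2]
    rw [map_add, map_mul, Complex.conj_ofReal, mul_add, mul_left_comm, h1]
    ring
  simp only [if_true, eq_comm (a := 0) (b := j)]
  have h4 : -s * ((if j = 0 then 1 else 0) - (u j + if j = 0 then s else 0) * conj (u 0 + s) /
      (1 + ‖u 0‖)) = -s * (if j = 0 then 1 else 0) +
        (u j + if j = 0 then s else 0) * ((s * conj (u 0 + s)) / (1 + ‖u 0‖)) := by ring
  rw [h4, h3, div_self h0]
  split_ifs <;> ring

/-- Let `v` be `u` with `s` added to its entry `0`. For a unit vector `u`, `‖v‖² = 2 (1 + ‖u 0‖)`,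
so the matrix is `-s` times the reflection in the entrywise conjugate of `v`. -/
theorem householderRow_mem_unitaryGroup
    (hu : 0 < d → ∑ j ∈ Finset.range d, u j * conj (u j) = 1) :
    (householderRow d u).submatrix (Fin.val : Fin d → ℕ) (Fin.val : Fin d → ℕ) ∈
      Matrix.unitaryGroup (Fin d) ℂ := by
  rw [Matrix.mem_unitaryGroup_iff]
  ext ⟨i, hi⟩ ⟨j, hj⟩
  have hd : 0 < d := by omega
  have h0 : (1 + ‖u 0‖ : ℂ) ≠ 0 := by
    have : (0 : ℝ) < 1 + ‖u 0‖ := by positivity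
    exact_mod_cast this.ne'
  set s := complexPhase (u 0) with hs
  have h1 : s * conj s = 1 := complexPhase_mul_conj _
  have h2 : ‖u 0‖ * s = u 0 := norm_mul_complexPhase _
  set v : ℕ → ℂ := fun j => u j + if j = 0 then s else 0 with hv
  have hA : ∀ i < d, ∀ j < d, householderRow d u i j =
      -s * ((if i = j then 1 else 0) - v j * conj (v i) / (1 + ‖u 0‖)) := fun i hi j hj => by
    rw [householderRow, if_pos ⟨hi, hj⟩]
  have hvv : ∑ l ∈ Finset.range d, v l * conj (v l) = 2 * (1 + ‖u 0‖) := by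
    have e : ∀ l, v l * conj (v l) = u l * conj (u l) +
        if l = 0 then u 0 * conj s + s * conj (u 0) + s * conj s else 0 := by
      intro l
      by_cases hl : l = 0
      · subst hl
        simp only [hv, if_true, map_add]
        ring
      · simp [hv, hl]
    simp_rw [e]
    rw [Finset.sum_add_distrib, hu hd, Finset.sum_ite_eq' (Finset.range d) 0,
      if_pos (by simpa using hd)]
    have h3 : u 0 * conj s = ‖u 0‖ := by
      nth_rw 1 [← h2]
      rw [mul_assoc, h1, mul_one]
    have h4 : s * conj (u 0) = ‖u 0‖ := by
      nth_rw 1 [← h2]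
      rw [map_mul, Complex.conj_ofReal, mul_left_comm, h1, mul_one]
    rw [h1, h3, h4]
    ring
  rw [Matrix.mul_apply]
  -- The product of two entries, expanded so that the sum over `l` involves only Kronecker deltas
  -- and `‖v‖²`.
  let F : ℕ → ℂ := fun l => (if i = l then (if j = l then 1 else 0) else 0) -
    (if i = l then conj (v l) * v j / (1 + ‖u 0‖) else 0) -
    (if j = l then v l * conj (v i) / (1 + ‖u 0‖) else 0) +
    conj (v i) * v j / (1 + ‖u 0‖) ^ 2 * (v l * conj (v l))
  have hterm : ∀ l : Fin d, (householderRow d u).submatrix Fin.val Fin.val ⟨i, hi⟩ l *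
      (star ((householderRow d u).submatrix Fin.val Fin.val)) l ⟨j, hj⟩ = F l := by
    intro l
    rw [Matrix.star_apply, Matrix.submatrix_apply, Matrix.submatrix_apply, hA i hi l l.2,
      hA j hj l l.2]
    change _ * conj _ = _
    simp only [map_mul, map_neg, map_sub, map_div₀, map_add, map_one, Complex.conj_ofReal,
      Complex.conj_conj, apply_ite conj, map_zero]
    have h5 : ∀ a b : ℂ, -s * a * (-conj s * b) = a * b := fun a b => by
      linear_combination (a * b) * h1
    rw [h5]
    simp only [F]
    generalize (1 + ‖u 0‖ : ℂ) = a
    split_ifs <;> ring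
  rw [Finset.sum_congr rfl fun l _ => hterm l, ← Finset.sum_range F]
  simp only [F]
  rw [Finset.sum_add_distrib, Finset.sum_sub_distrib, Finset.sum_sub_distrib, ← Finset.mul_sum,
    hvv, Finset.sum_ite_eq, Finset.sum_ite_eq, Finset.sum_ite_eq, Matrix.one_apply]
  simp only [Finset.mem_range, hi, hj, if_true]
  have h6 : conj (v i) * v j / (1 + ‖u 0‖) ^ 2 * (2 * (1 + ‖u 0‖)) =
      2 * (conj (v i) * v j / (1 + ‖u 0‖)) := by
    field_simp
  rw [h6]
  simp only [Fin.mk.injEq, eq_comm (a := j) (b := i)]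
  split_ifs <;> ring

end Householder

/-! ### Unitary fields and conjugation of filters -/

section UnitaryField

set_option linter.unusedSectionVars false

variable {Γ : Type*} [CommGroup Γ] [TopologicalSpace Γ] [DiscreteTopology Γ]
  {α : Γ →* Γ} {μ : Measure (PontryaginDual Γ)} {m : PontryaginDual Γ → ℕ}
  {H A : PontryaginDual Γ → Matrix ℕ ℕ ℂ}

theorem isUnitaryField_householderRow (hm : Measurable m) {u : ℕ → PontryaginDual Γ → ℂ}
    (hu : ∀ i, Measurable (u i))
    (hu1 : ∀ ω, 0 < m ω → fiberInner m u u ω = 1) :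
    IsUnitaryField m fun ω => householderRow (m ω) fun i => u i ω where
  measurable i j := by
    have hs : Measurable fun ω => complexPhase (u 0 ω) := measurable_complexPhase.comp (hu 0)
    have hv : ∀ i, Measurable fun ω => u i ω + if i = 0 then complexPhase (u 0 ω) else 0 :=
      fun i => (hu i).add (by split_ifs; exacts [hs, measurable_const])
    refine Measurable.ite ((hm measurableSet_Ioi).inter (hm measurableSet_Ioi)) ?_ measurable_const
    exact hs.neg.mul (measurable_const.sub (((hv j).mul
      (Complex.continuous_conj.measurable.comp (hv i))).div
        (measurable_const.add (Complex.measurable_ofReal.comp (hu 0).norm))))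
  zero ω i j h := if_neg (by omega)
  unitary ω := householderRow_mem_unitaryGroup (hu1 ω)

namespace IsUnitaryField

theorem sum_mul_conj (hA : IsUnitaryField m A) (ω : PontryaginDual Γ) (i i' : ℕ) :
    ∑ k ∈ Finset.range (m ω), A ω i k * conj (A ω i' k) =
      if i = i' ∧ i < m ω then 1 else 0 := by
  by_cases hi : i < m ω
  · by_cases hi' : i' < m ω
    · have h := congrFun (congrFun (Matrix.mem_unitaryGroup_iff.1 (hA.unitary ω)) ⟨i, hi⟩) ⟨i', hi'⟩
      rw [Matrix.mul_apply, Matrix.one_apply] at h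
      simp only [Fin.mk.injEq] at h
      rw [Finset.sum_range]
      simpa [hi] using h
    · rw [if_neg (by rintro ⟨rfl, h⟩; exact hi' h)]
      exact Finset.sum_eq_zero fun k _ => by
        rw [hA.zero ω i' k (Or.inl (by omega)), map_zero, mul_zero]
  · rw [if_neg (by tauto)]
    exact Finset.sum_eq_zero fun k _ => by rw [hA.zero ω i k (Or.inl (by omega)), zero_mul]

theorem sum_conj_mul (hA : IsUnitaryField m A) (ω : PontryaginDual Γ) {i i' : ℕ} (hi : i < m ω)
    (hi' : i' < m ω) :
    ∑ k ∈ Finset.range (m ω), conj (A ω k i) * A ω k i' = if i = i' then 1 else 0 := by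
  have h := congrFun (congrFun (Matrix.mem_unitaryGroup_iff'.1 (hA.unitary ω)) ⟨i, hi⟩) ⟨i', hi'⟩
  rw [Matrix.mul_apply, Matrix.one_apply] at h
  simp only [Fin.mk.injEq] at h
  rw [Finset.sum_range]
  simpa using h

theorem sum_sum_mul_conj_mul (hA : IsUnitaryField m A) (ω : PontryaginDual Γ) (p : ℕ → ℂ) {i : ℕ}
    (hi : i < m ω) :
    ∑ j ∈ Finset.range (m ω), (∑ l ∈ Finset.range (m ω), p l * conj (A ω j l)) * A ω j i =
      p i := by
  simp_rw [Finset.sum_mul, mul_assoc]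
  rw [Finset.sum_comm]
  simp_rw [← Finset.mul_sum]
  rw [Finset.sum_eq_single_of_mem i (by simpa using hi)]
  · rw [hA.sum_conj_mul ω hi hi, if_pos rfl, mul_one]
  · intro l hl hli
    rw [hA.sum_conj_mul ω (by simpa using hl) hi, if_neg hli, mul_zero]

theorem sum_mul_conj_of_sum (hA : IsUnitaryField m A) (ω : PontryaginDual Γ) (p q : ℕ → ℂ) :
    ∑ j ∈ Finset.range (m ω), (∑ l ∈ Finset.range (m ω), p l * conj (A ω j l)) *
        conj (∑ l ∈ Finset.range (m ω), q l * conj (A ω j l)) =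
      ∑ l ∈ Finset.range (m ω), p l * conj (q l) := by
  have e : ∀ j, (∑ l ∈ Finset.range (m ω), p l * conj (A ω j l)) *
      conj (∑ l ∈ Finset.range (m ω), q l * conj (A ω j l)) =
      ∑ i ∈ Finset.range (m ω), conj (q i) *
        ((∑ l ∈ Finset.range (m ω), p l * conj (A ω j l)) * A ω j i) := by
    intro j
    rw [map_sum, Finset.mul_sum]
    refine Finset.sum_congr rfl fun i _ => ?_
    rw [map_mul, Complex.conj_conj]
    ring
  simp_rw [e]
  rw [Finset.sum_comm]
  refine Finset.sum_congr rfl fun i hi => ?_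
  rw [← Finset.mul_sum, hA.sum_sum_mul_conj_mul ω p (by simpa using hi), mul_comm]

end IsUnitaryField

/-- The matrix function `A(α* ω) H(ω) A(ω)*`. -/
noncomputable def conjFilter (α : Γ →* Γ) (m : PontryaginDual Γ → ℕ) (A H : PontryaginDual Γ → Matrix ℕ ℕ ℂ)
    (ω : PontryaginDual Γ) : Matrix ℕ ℕ ℂ := fun i j =>
  ∑ k ∈ Finset.range (m (dualEnd α ω)), ∑ l ∈ Finset.range (m ω),
    A (dualEnd α ω) i k * H ω k l * conj (A ω j l)

/-- Row `i` of `A(α* ω) H(ω)` is the Ruelle formula applied to row `i` of `A`. Both implications of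
the theorem use this for the first row. -/
theorem conjFilter_apply (ω : PontryaginDual Γ) (i j : ℕ) :
    conjFilter α m A H ω i j = ∑ l ∈ Finset.range (m ω),
      ruelleFun α m H (fun k ω => A ω i k) l ω * conj (A ω j l) := by
  rw [conjFilter, Finset.sum_comm]
  refine Finset.sum_congr rfl fun l _ => ?_
  rw [ruelleFun, Finset.sum_mul]
  exact Finset.sum_congr rfl fun k _ => by ring

/-- The right factor `A(ω)*` preserves inner products of rows. The left factor `A(α* ω)` is constant
on each fiber and turns `N` times the identity block into `N A A*`, which is the same. -/
theorem isFilter_conjFilter [Countable Γ] (hα : IsDilation α) [μ.IsHaarMeasure]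
    (hm : Measurable m) (hH : IsFilter μ α m H) (hA : IsUnitaryField m A) :
    IsFilter μ α m (conjFilter α m A H) where
  measurable i j := by
    simp_rw [conjFilter_apply]
    exact measurable_sum_range hm fun l =>
      (measurable_ruelleFun hm hH.measurable (fun k => hA.measurable i k) l).mul
        (Complex.continuous_conj.measurable.comp (hA.measurable j l))
  support i j := .of_forall fun ω hω => by
    rw [conjFilter_apply]
    refine Finset.sum_eq_zero fun l _ => ?_
    rw [hA.zero ω j l (Or.inl (by simpa [sigmaSet] using hω)), map_zero, mul_zero]
  filter_eq i i' := by
    have := hα.finite_dualKer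
    have := Fintype.ofFinite (dualKer α)
    refine ae_of_ae_dualEnd hα ?_
    filter_upwards [hH.ae_dualEnd hα] with ω ⟨h1, h2⟩
    have hk : ∀ κ : dualKer α, dualEnd α (ω * (κ : PontryaginDual Γ)) = dualEnd α ω := fun κ => by
      rw [map_mul, κ.2, mul_one]
    rw [fiberSum_dualEnd]
    have e : ∀ κ : dualKer α, ∑' j, conjFilter α m A H (ω * κ) i j *
        conj (conjFilter α m A H (ω * κ) i' j) =
        ∑ l ∈ Finset.range (m (ω * (κ : PontryaginDual Γ))),
          (∑ k ∈ Finset.range (m (dualEnd α ω)), H (ω * κ) k l * A (dualEnd α ω) i k) *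
          conj (∑ k ∈ Finset.range (m (dualEnd α ω)), H (ω * κ) k l * A (dualEnd α ω) i' k) := by
      intro κ
      rw [tsum_eq_sum (s := Finset.range (m (ω * (κ : PontryaginDual Γ))))]
      · simp_rw [conjFilter_apply]
        rw [hA.sum_mul_conj_of_sum]
        simp_rw [ruelleFun, hk]
      · intro j hj
        have h0 : conjFilter α m A H (ω * κ) i j = 0 := by
          rw [conjFilter_apply]
          refine Finset.sum_eq_zero fun l _ => ?_
          rw [hA.zero _ j l (Or.inl (by simpa using hj)), map_zero, mul_zero]
        rw [h0, zero_mul]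
    simp_rw [e]
    rw [sum_mul_conj_matrix (m (dualEnd α ω))
      (fun κ : dualKer α => m (ω * (κ : PontryaginDual Γ))) α.range.index
      (fun κ i j => H (ω * κ) i j) h1 (fun i hi i' _ => by simp [h2, hi])
      (A (dualEnd α ω) i) (A (dualEnd α ω) i'), hA.sum_mul_conj]
    by_cases hi : i = i' <;> by_cases hi' : i < m (dualEnd α ω) <;>
      simp [hi, hi', sigmaSet, Set.indicator]

end UnitaryField

/-! ### The two implications -/

section Main

set_option linter.unusedSectionVars false

variable {Γ : Type*} [CommGroup Γ] [TopologicalSpace Γ] [DiscreteTopology Γ] [Countable Γ]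
  {α : Γ →* Γ} {μ : Measure (PontryaginDual Γ)} {m : PontryaginDual Γ → ℕ}
  {H : PontryaginDual Γ → Matrix ℕ ℕ ℂ}

theorem exists_isEigenfilter_of_not_isPureIsometry (hα : IsDilation α) [μ.IsHaarMeasure]
    (hm : Measurable m) (hH : IsFilter μ α m H) (hS : ¬ IsPureIsometry (ruelle hα hm hH)) :
    ∃ H', IsEigenfilter μ α m H' ∧ FilterEquiv μ α m H H' := by
  obtain ⟨f, c, hc, hSf, hf1⟩ := exists_fiberwise_unit_eigenvector hα hm hH hS
  have hf := CoreSpace.measurable f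
  set g := fiberInner m (fun i => f i) (fun i => f i) with hg
  -- `IsUnitaryField` asks for unitarity at every point, so `f` is replaced by the first basis
  -- vector where its pointwise norm is not `1`.
  let u : ℕ → PontryaginDual Γ → ℂ := fun i ω => if g ω = 1 then f i ω else if i = 0 then 1 else 0
  have hu : ∀ i, Measurable (u i) := fun i =>
    Measurable.ite (measurable_fiberInner hm hf hf (measurableSet_singleton 1)) (hf i)
      measurable_const
  have hu1 : ∀ ω, 0 < m ω → fiberInner m u u ω = 1 := by
    intro ω hω
    by_cases h : g ω = 1
    · simp only [fiberInner, u, if_pos h]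
      exact h
    · simp only [fiberInner, u, if_neg h]
      rw [Finset.sum_eq_single_of_mem 0 (by simpa using hω)]
      · simp
      · intro b _ hb
        simp [hb]
  have hA := isUnitaryField_householderRow hm hu hu1
  set A : PontryaginDual Γ → Matrix ℕ ℕ ℂ := fun ω => householderRow (m ω) fun i => u i ω with hAdef
  have hA0 : ∀ ω, g ω = 1 → ∀ k < m ω, A ω 0 k = f k ω := fun ω hω k hk => by
    simp only [hAdef]
    rw [householderRow_zero hk]
    exact if_pos hω
  refine ⟨conjFilter α m A H, ⟨isFilter_conjFilter hα hm hH hA, c, hc, ?_⟩, A, hA,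
    .of_forall fun ω i j => rfl⟩
  have hSω : ∀ᵐ ω ∂μ, ∀ j, ω ∈ sigmaSet m j →
      ruelleFun α m H (fun i => f i) j ω = c * f j ω := ae_all_iff.2 fun j => by
    rw [← ae_restrict_iff' (measurableSet_sigmaSet hm j)]
    have h1 := ruelle_apply_ae hα hm hH f j
    rw [hSf] at h1
    filter_upwards [h1, Lp.coeFn_smul c (f j)] with ω h1 h2
    exact h1.symm.trans h2
  filter_upwards [hf1, (dualEnd_measurePreserving hα μ).quasiMeasurePreserving.ae hf1, hSω]
    with ω h1 h2 h3
  have hm0 : 0 < m ω := by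
    by_contra h0
    rw [hg, fiberInner, Nat.eq_zero_of_not_pos h0] at h1
    simp at h1
  -- The first row is `(S_H f)ᵗ A* = c fᵗ A*`, and `f` is the first row of the unitary `A`.
  have key : ∀ j, conjFilter α m A H ω 0 j = c * if 0 = j ∧ 0 < m ω then 1 else 0 := fun j => by
    rw [conjFilter_apply, ← hA.sum_mul_conj ω 0 j, Finset.mul_sum]
    refine Finset.sum_congr rfl fun l hl => ?_
    have hl' : l < m ω := by simpa using hl
    rw [hA0 ω h1 l hl', ← mul_assoc, ← h3 l hl']
    congr 1
    exact Finset.sum_congr rfl fun k hk =>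
      congrArg (H ω k l * ·) (hA0 _ h2 k (by simpa using hk))
  refine ⟨by simp [key, hm0], fun j hj => ?_⟩
  rw [key, if_neg (by omega), mul_zero]

theorem exists_coreSpace_of_tsum_lintegral_ne_top {g : ℕ → PontryaginDual Γ → ℂ}
    (hg : ∀ i, Measurable (g i)) (h : ∑' i, ∫⁻ ω in sigmaSet m i, ‖g i ω‖ₑ ^ 2 ∂μ ≠ ∞) :
    ∃ G : CoreSpace μ m, ∀ i, G i =ᵐ[μ.restrict (sigmaSet m i)] g i := by
  have hL : ∀ i, MemLp (g i) 2 (μ.restrict (sigmaSet m i)) := fun i => by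
    refine ⟨(hg i).aestronglyMeasurable, ?_⟩
    have h3 := ENNReal.ne_top_of_tsum_ne_top h i
    have h4 := eLpNorm_nnreal_pow_eq_lintegral (f := g i)
      (μ := μ.restrict (sigmaSet m i)) (p := 2) two_ne_zero
    simp only [NNReal.coe_ofNat, ENNReal.rpow_ofNat, ENNReal.coe_ofNat] at h4
    rw [← h4] at h3
    exact lt_top_iff_ne_top.2 fun h => h3 (by rw [h]; simp)
  refine ⟨⟨fun i => (hL i).toLp _, (memℓp_two_iff _).2 ?_⟩, fun i => (hL i).coeFn_toLp⟩
  convert h using 1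
  refine tsum_congr fun i => ?_
  rw [Lp_enorm_sq]
  exact lintegral_congr_ae ((hL i).coeFn_toLp.mono fun ω hω => by simp only [hω])

/-- A row of `A` has pointwise norm at most `1` and `μ` is finite. -/
theorem IsUnitaryField.exists_coreSpace_row [IsFiniteMeasure μ] (hm : Measurable m)
    {A : PontryaginDual Γ → Matrix ℕ ℕ ℂ} (hA : IsUnitaryField m A) (i : ℕ) :
    ∃ G : CoreSpace μ m, ∀ j, G j =ᵐ[μ.restrict (sigmaSet m j)] fun ω => A ω i j := by
  refine exists_coreSpace_of_tsum_lintegral_ne_top (fun j => hA.measurable i j) ?_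
  simp_rw [← lintegral_indicator (measurableSet_sigmaSet hm _)]
  rw [← lintegral_tsum fun j =>
    (((hA.measurable i j).enorm.pow_const 2).indicator (measurableSet_sigmaSet hm j)).aemeasurable]
  refine ne_top_of_le_ne_top (measure_ne_top μ Set.univ) ?_
  rw [← lintegral_one]
  refine lintegral_mono fun ω => ?_
  rw [tsum_eq_sum (s := Finset.range (m ω)) fun j hj =>
    Set.indicator_of_notMem (by simpa [sigmaSet] using hj) _]
  have h1 : ∑ j ∈ Finset.range (m ω), ‖A ω i j‖ ^ 2 ≤ 1 := by
    have h := hA.sum_mul_conj ω i i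
    simp_rw [Complex.mul_conj'] at h
    have h' : ((∑ j ∈ Finset.range (m ω), ‖A ω i j‖ ^ 2 : ℝ) : ℂ) =
        ((if i = i ∧ i < m ω then 1 else 0 : ℝ) : ℂ) := by
      push_cast
      rw [h]
      by_cases hi : i < m ω <;> simp [hi]
    rw [Complex.ofReal_injective h']
    split_ifs <;> norm_num
  calc _ = ∑ j ∈ Finset.range (m ω), ENNReal.ofReal (‖A ω i j‖ ^ 2) := by
        refine Finset.sum_congr rfl fun j hj => ?_
        rw [Set.indicator_of_mem (show ω ∈ sigmaSet m j by simpa [sigmaSet] using hj),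
          ENNReal.ofReal_pow (norm_nonneg _), ofReal_norm]
    _ ≤ 1 := by
        rw [← ENNReal.ofReal_sum_of_nonneg fun j _ => by positivity]
        exact ENNReal.ofReal_le_one.2 h1

/-- Multiplying the first row of `H' = A(α* ω) H A*` on the right by `A` shows that the first row of
`A` is an eigenvector of `S_H` with eigenvalue `c`. -/
theorem not_isPureIsometry_of_isEigenfilter (hα : IsDilation α) [μ.IsHaarMeasure]
    (hm : Measurable m) (hH : IsFilter μ α m H) {H' : PontryaginDual Γ → Matrix ℕ ℕ ℂ}
    (hH' : IsEigenfilter μ α m H') (hE : FilterEquiv μ α m H H') :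
    ¬ IsPureIsometry (ruelle hα hm hH) := by
  obtain ⟨A, hA, hAH⟩ := hE
  obtain ⟨c, hc, hH'c⟩ := hH'.exists_eigenvalue
  have hc0 : c ≠ 0 := norm_ne_zero_iff.1 (by rw [hc]; exact one_ne_zero)
  obtain ⟨G, hG⟩ := hA.exists_coreSpace_row (μ := μ) hm 0
  have hSG : ruelle hα hm hH G = c • G := by
    refine lp.ext (funext fun j => Lp.ext ?_)
    have h1 := ae_restrict_of_ae (s := sigmaSet m j)
      (ruelleFun_congr_ae (H := H) hα hm (f := fun i => G i) hG j)
    filter_upwards [ruelle_apply_ae hα hm hH G j, h1, Lp.coeFn_smul c (G j), hG j,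
      ae_restrict_of_ae hAH, ae_restrict_of_ae hH'c,
      ae_restrict_mem (measurableSet_sigmaSet hm j)] with ω h1 h2 h3 h4 h5 h6 hj
    have hj' : j < m ω := hj
    refine (h1.trans h2).trans (Eq.trans ?_ h3.symm)
    rw [Pi.smul_apply, h4, smul_eq_mul, ← hA.sum_sum_mul_conj_mul ω
      (fun l => ruelleFun α m H (fun k ω => A ω 0 k) l ω) hj']
    have h7 : ∀ l, ∑ l' ∈ Finset.range (m ω),
        ruelleFun α m H (fun k ω => A ω 0 k) l' ω * conj (A ω l l') = H' ω 0 l := fun l => by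
      rw [← conjFilter_apply, h5]
      rfl
    simp_rw [h7]
    rw [Finset.sum_eq_single_of_mem 0 (by simpa using (Nat.zero_le j).trans_lt hj'), h6.1]
    intro l _ hl
    rw [h6.2 l (Nat.pos_of_ne_zero hl), zero_mul]
  intro hpure
  rw [LinearIsometry.isPureIsometry_iff] at hpure
  have hmem := LinearIsometry.mem_iInfRange_of_apply_eq_smul hc0 hSG
  rw [hpure, Submodule.mem_bot] at hmem
  have h0 : ∀ᵐ ω ∂μ, ∀ j, ω ∈ sigmaSet m j → A ω 0 j = 0 := ae_all_iff.2 fun j => by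
    rw [← ae_restrict_iff' (measurableSet_sigmaSet hm j)]
    have h1 := hG j
    rw [hmem] at h1
    filter_upwards [h1, Lp.coeFn_zero ℂ 2 (μ.restrict (sigmaSet m j))] with ω h1 h2
    exact h1.symm.trans h2
  -- The eigenvector is nonzero: the entry `H' ω 0 0 = c ≠ 0` and the support condition force `m ω >
  -- 0`, where the first row of `A` is a unit vector.
  obtain ⟨ω, h1, h2, h3⟩ := (h0.and (hH'c.and (hH'.support 0 0))).exists
  have hm0 : 0 < m ω := by
    by_contra h
    exact hc0 (h2.1.symm.trans (h3 h))
  have h4 := hA.sum_mul_conj ω 0 0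
  rw [if_pos ⟨rfl, hm0⟩, Finset.sum_eq_zero fun k hk => by
    rw [h1 k (by simpa [sigmaSet] using hk), zero_mul]] at h4
  exact zero_ne_one h4

end Main

theorem mainTheorem5 {Γ : Type*} [CommGroup Γ] [Countable Γ] [TopologicalSpace Γ]
    [DiscreteTopology Γ] {α : Γ →* Γ} (hα : IsDilation α)
    (μ : Measure (PontryaginDual Γ)) [μ.IsHaarMeasure]
    {m : PontryaginDual Γ → ℕ} (hm : IsMultiplicityFunction μ α m)
    {H : PontryaginDual Γ → Matrix ℕ ℕ ℂ} (hH : IsFilter μ α m H) :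
    ¬ IsPureIsometry (ruelle hα hm.1 hH) ↔
      ∃ H' : PontryaginDual Γ → Matrix ℕ ℕ ℂ,
        IsEigenfilter μ α m H' ∧ FilterEquiv μ α m H H' :=
  ⟨exists_isEigenfilter_of_not_isPureIsometry hα hm.1 hH, fun ⟨_, hH', hE⟩ =>
    not_isPureIsometry_of_isEigenfilter hα hm.1 hH hH' hE⟩
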